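/- For a positive integer $l$, let $B_l$ be the basis of all Boolean functions of at most $l$ variables. A Boolean function is read-once over $B_l$ if it is expressed by a formula over $B_l$ in which no variable appears more than once. A variable $x_i$ is relevant to a Boolean function $f$ (and $f$ depends on $x_i$) if $f(\alpha)\neq f(\beta)$ for some vectors $\alpha,\beta$ that differ only in the $i$-th component. Let $f(x_1,\dots,x_n)$ be a Boolean function. A relevance hypercube for a set $\mathbf w$ of $l$ variables of $f$ is a set $H\subseteq\{0,1\}^n$ of $2^l$ vectors obtained by fixing the values of all variables outside $\mathbf w$ to constants and letting the variables in $\mathbf w$ range over all values, such that the restriction of $f$ to $H$, as a function of the $l$ variables in $\mathbf w$, depends on all of them. A relevance hypercube set of dimension $l$ for $f$ is a set $M\subseteq\{0,1\}^n$ that contains, for every $l$-element set $\mathbf w$ of variables relevant to $f$ for which a relevance hypercube exists, at least one relevance hypercube for $\mathbf w$. **Theorem.** Let $n\ge l\ge 3$, let $f(x_1,\dots,x_n)$ be a read-once function over $B_l$ that depends on all its variables, and let $M$ be any relevance hypercube set of dimension $l$ for $f$. Then $M$ is a checking test for $f$: for every read-once function $g(x_1,\dots,x_n)\neq f$ over $B_l$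 (possibly with irrelevant variables) there is a vector $\alpha\in M$ with $f(\alpha)\neq g(\alpha)$. -/

import Mathlib

namespace CheckingTest

/-- Boolean functions of the variables `V`. -/
abbrev BoolFun (V : Type*) : Type _ := (V → Bool) → Bool

/-- A basis: a set of Boolean functions of finitely many variables, each given with its arity. -/
abbrev Basis : Type := Set (Σ k : ℕ, BoolFun (Fin k))

/-- The basis `B_l` of all `l`-variable Boolean functions. As usual, functions are identified
when they differ only in fictitious variables, so these are all functions of arity at most `l`. -/
def basisB (l : ℕ) : Basis := {h | h.1 ≤ l}

/-- Formulas over a basis `B` with variables from `V`. -/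
inductive Formula (B : Basis) (V : Type*) : Type _
  | var (x : V) : Formula B V
  | app (h : Σ k : ℕ, BoolFun (Fin k)) (hB : h ∈ B) (args : Fin h.1 → Formula B V) : Formula B V

namespace Formula

variable {B : Basis} {V : Type*}

/-- The Boolean function expressed by a formula. -/
def eval : Formula B V → BoolFun V
  | var x, α => α x
  | app h _ args, α => h.2 fun i => (args i).eval α

/-- The number of occurrences of the variable `x` in a formula. -/
def occ [DecidableEq V] (x : V) : Formula B V → ℕ
  | var y => if y = x then 1 else 0
  | app _ _ args => ∑ i, (args i).occ x

end Formula

/-- `f` is read-once over `B`: it is expressed by a formula over `B` in which no variable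
appears more than once (some variables may not appear at all). -/
def IsReadOnce {V : Type*} [DecidableEq V] (B : Basis) (f : BoolFun V) : Prop :=
  ∃ F : Formula B V, (∀ x, F.occ x ≤ 1) ∧ F.eval = f

/-- The variable `i` is relevant to the restriction of `f` to the set `H` of vectors: there are
two vectors in `H` that differ only in component `i` and on which `f` takes different values. -/
def IsRelevantOn {V : Type*} (f : BoolFun V) (H : Set (V → Bool)) (i : V) : Prop :=
  ∃ α ∈ H, ∃ β ∈ H, (∀ j, j ≠ i → α j = β j) ∧ f α ≠ f β

/-- The variable `i` is relevant to `f`, that is, `f` depends on `i`. -/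
def IsRelevant {V : Type*} (f : BoolFun V) (i : V) : Prop :=
  IsRelevantOn f Set.univ i

/-- The subcube with free components `w`, all other components being fixed as in `p`. It has
`2 ^ w.card` elements. -/
def subcube {V : Type*} (w : Finset V) (p : V → Bool) : Set (V → Bool) :=
  {α | ∀ j, j ∉ w → α j = p j}

/-- `H` is a relevance hypercube for the variables `w` of `f`; its dimension is `w.card`. -/
def IsRelevanceHypercube {V : Type*} (f : BoolFun V) (w : Finset V) (H : Set (V → Bool)) : Prop :=
  (∃ p, H = subcube w p) ∧ ∀ i ∈ w, IsRelevantOn f H i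

/-- `M` is a relevance hypercube set of dimension `l` for `f`: it contains a relevance hypercube
for every `l`-element set of relevant variables of `f` that admits one. -/
def IsRelevanceHypercubeSet {V : Type*} (l : ℕ) (f : BoolFun V) (M : Set (V → Bool)) : Prop :=
  ∀ w : Finset V, w.card = l → (∀ i ∈ w, IsRelevant f i) →
    (∃ H, IsRelevanceHypercube f w H) → ∃ H, IsRelevanceHypercube f w H ∧ H ⊆ M

/-- `M` is a checking test for `f` with respect to read-once functions over `B`: every other
read-once function of the same variables, possibly with irrelevant variables, differs from `f`
on some vector of `M`. -/
def IsCheckingTest {V : Type*} [DecidableEq V] (B : Basis) (f : BoolFun V)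
    (M : Set (V → Bool)) : Prop :=
  ∀ g : BoolFun V, IsReadOnce B g → g ≠ f → ∃ α ∈ M, f α ≠ g α

end CheckingTest

/-! A set `A` of variables is a module of `f` if `f` sees `A` only through one Boolean function `h`
of `A` (`Fac`). Suppose `f` and `g` agree on a relevance hypercube of `f` for every `l`-set
admitting one. Equality follows by induction on the number of relevant variables (`eq_of_agreeOn`):
find a set of at least two variables that is a module of both functions with the same `h`, contract
it to a single variable, and apply induction. If fewer than `l` variables would remain, they all fit
into one `l`-hypercube and equality can be read off there (`Fac.eq_of_agreeOn`).

Agreement on `l`-sets yields agreement on smaller sets `S` in two steps. A set with a relevance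
hypercube extends to an `l`-set with one (`SepEx.extend`). If `S` is robust, every hypercube for the
larger set contains one for `S`. Transversals of a node (one variable per branch) are robust, and on
their hypercubes `f` is the node function `q` up to negations.

To find the common module, write both functions as read-once trees whose inner nodes are binary or
prime. A lowest node of `g` gives a module with at most `l` variables; let `A` be a smallest
nontrivial module of `g`. Descend the tree of `f` (`RO.exists_fac_of_module`). At a prime node,
transversals show that `A` lies in one branch or contains all of them. At a binary node met by `A`
on both sides, minimality forces `A = {a, b}` with one variable in each branch.

This last case is the crux (`Node.pair_module`): each branch must depend on its variable of the pair
as `g` does, as in a conjunction or as in a sum. `RO.lin` proves this by induction along the path to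
`a`. At a node with fewer than `l` branches, a transversal together with `b` is small enough to
test. At a prime node with `l` branches it has `l + 1` elements, and rigidity helps instead
(`RO.rigid`): a prime projection of `g` to `l` variables determines all other projections to them,
up to negations. Since `{a, b}` is a module of `g`, `b` can play the role of `a` in such a
projection (`Node.exists_transport`). -/

namespace CheckingTest

/-! ### Sensitivity, relevance hypercubes, modules, and extension of sets having a hypercube. -/

section Basics

set_option linter.unusedSectionVars false

variable {V : Type*} [DecidableEq V]

/-- The vector `α` with component `i` negated. -/
def flipAt (α : V → Bool) (i : V) : V → Bool := Function.update α i (!α i)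

@[simp] lemma flipAt_self (α : V → Bool) (i : V) : flipAt α i i = !α i := by simp [flipAt]

lemma flipAt_of_ne (α : V → Bool) {i j : V} (h : j ≠ i) : flipAt α i j = α j := by
  simp [flipAt, h]

@[simp] lemma flipAt_flipAt (α : V → Bool) (i : V) : flipAt (flipAt α i) i = α := by
  funext j
  by_cases h : j = i
  · subst h; simp
  · simp [flipAt_of_ne _ h]

lemma flipAt_comm (α : V → Bool) (i j : V) :
    flipAt (flipAt α i) j = flipAt (flipAt α j) i := by
  funext k
  by_cases hi : k = i <;> by_cases hj : k = j
  · subst hi; subst hj; rfl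
  · subst hi; simp [flipAt_of_ne _ hj]
  · subst hj; simp [flipAt_of_ne _ hi]
  · simp [flipAt_of_ne _ hi, flipAt_of_ne _ hj]

/-- `f` changes its value when component `i` of `α` is negated. -/
def Sens (f : BoolFun V) (α : V → Bool) (i : V) : Prop := f (flipAt α i) ≠ f α

lemma Sens.flip {f : BoolFun V} {α : V → Bool} {i : V} (h : Sens f α i) :
    Sens f (flipAt α i) i := by
  unfold Sens at *; rw [flipAt_flipAt]; exact h.symm

/-- `α` and `β` agree outside `W`. -/
def EqOff (W : Finset V) (α β : V → Bool) : Prop := ∀ j, j ∉ W → α j = β j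

lemma EqOff.refl (W : Finset V) (α : V → Bool) : EqOff W α α := fun _ _ => rfl

lemma EqOff.symm {W : Finset V} {α β : V → Bool} (h : EqOff W α β) : EqOff W β α :=
  fun j hj => (h j hj).symm

lemma EqOff.trans {W : Finset V} {α β γ : V → Bool} (h : EqOff W α β) (h' : EqOff W β γ) :
    EqOff W α γ := fun j hj => (h j hj).trans (h' j hj)

lemma EqOff.mono {W W' : Finset V} {α β : V → Bool} (h : EqOff W α β) (hW : W ⊆ W') :
    EqOff W' α β := fun j hj => h j fun hj' => hj (hW hj')

lemma eqOff_flipAt {W : Finset V} {i : V} (hi : i ∈ W) (α : V → Bool) :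
    EqOff W (flipAt α i) α :=
  fun _ hj => flipAt_of_ne _ fun h => hj (h ▸ hi)

lemma EqOff.flip {W : Finset V} {i : V} {α β : V → Bool} (h : EqOff W α β) (hi : i ∈ W) :
    EqOff W (flipAt α i) β := (eqOff_flipAt hi α).trans h

/-- `e` depends on the variables of `U` only. -/
def DepOn (e : BoolFun V) (U : Finset V) : Prop :=
  ∀ α β : V → Bool, (∀ i ∈ U, α i = β i) → e α = e β

lemma DepOn.mem {e : BoolFun V} {U : Finset V} (h : DepOn e U) {α : V → Bool} {i : V}
    (hs : Sens e α i) : i ∈ U := by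
  by_contra hi
  exact hs (h _ _ fun j hj => flipAt_of_ne _ fun hji => hi (hji ▸ hj))

lemma DepOn.sens {e : BoolFun V} {U : Finset V} (h : DepOn e U) {α β : V → Bool} {i : V}
    (hs : Sens e α i) (hαβ : ∀ j ∈ U, β j = α j) : Sens e β i := by
  unfold Sens
  rw [h β α hαβ, h (flipAt β i) (flipAt α i)]
  · exact hs
  · intro j hj
    by_cases hji : j = i
    · subst hji; simp [hαβ j hj]
    · rw [flipAt_of_ne _ hji, flipAt_of_ne _ hji, hαβ j hj]

lemma Sens.of_eqOff_single {f : BoolFun V} {α β : V → Bool} {i : V} (h : Sens f α i)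
    (hβ : EqOff {i} β α) : Sens f β i := by
  by_cases hi : β i = α i
  · have : β = α := by
      funext j
      by_cases hj : j = i
      · rw [hj, hi]
      · exact hβ j (by simpa using hj)
    rwa [this]
  · have : β = flipAt α i := by
      funext j
      by_cases hj : j = i
      · subst hj; simp only [flipAt_self]; revert hi; cases β j <;> cases α j <;> simp
      · rw [flipAt_of_ne _ hj]; exact hβ j (by simpa using hj)
    rw [this]; exact h.flip

lemma Sens.exists_value {f : BoolFun V} {α : V → Bool} {i : V} (h : Sens f α i) (v : Bool) :
    ∃ β, EqOff {i} β α ∧ f β = v := by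
  by_cases hv : f α = v
  · exact ⟨α, EqOff.refl _ _, hv⟩
  · refine ⟨flipAt α i, eqOff_flipAt (by simp) _, ?_⟩
    unfold Sens at h
    revert h hv
    cases f (flipAt α i) <;> cases f α <;> cases v <;> simp

/-- On the subcube with free components `W` through `p`, `f` depends on all variables of `W`. -/
def Sep (f : BoolFun V) (W : Finset V) (p : V → Bool) : Prop :=
  ∀ i ∈ W, ∃ α, EqOff W α p ∧ Sens f α i

/-- Some subcube with free components `W` is a relevance hypercube of `f`. -/
def SepEx (f : BoolFun V) (W : Finset V) : Prop := ∃ p, Sep f W p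

/-- The subcube with free components `W` through `p` contains a relevance hypercube for `S`. -/
def SepIn (f : BoolFun V) (S W : Finset V) (p : V → Bool) : Prop :=
  ∃ p', EqOff W p' p ∧ Sep f S p'

/-- Every relevance hypercube for a superset of `S` contains a relevance hypercube for `S`. -/
def Robust (f : BoolFun V) (S : Finset V) : Prop :=
  ∀ W p, S ⊆ W → Sep f W p → SepIn f S W p

/-- `f` and `g` agree on some relevance hypercube of `f` for `W`. -/
def AgreeOn (f g : BoolFun V) (W : Finset V) : Prop :=
  ∃ p, Sep f W p ∧ ∀ α, EqOff W α p → f α = g α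

lemma SepIn.sepEx {f : BoolFun V} {S W : Finset V} {p : V → Bool} (h : SepIn f S W p) :
    SepEx f S := ⟨h.choose, h.choose_spec.2⟩

lemma sep_singleton {f : BoolFun V} {α : V → Bool} {i : V} (h : Sens f α i) :
    Sep f {i} α := by
  intro j hj
  rw [Finset.mem_singleton] at hj
  subst hj
  exact ⟨α, EqOff.refl _ _, h⟩

lemma robust_singleton (f : BoolFun V) (i : V) : Robust f {i} := by
  intro W p hW hs
  obtain ⟨α, hα, h⟩ := hs i (hW (by simp))
  exact ⟨α, hα, sep_singleton h⟩

lemma isRelevanceHypercube_subcube {f : BoolFun V} {W : Finset V} {p : V → Bool} :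
    IsRelevanceHypercube f W (subcube W p) ↔ Sep f W p := by
  constructor
  · rintro ⟨-, h⟩ i hi
    obtain ⟨α, hα, β, hβ, hαβ, hne⟩ := h i hi
    refine ⟨α, hα, fun h => hne ?_⟩
    by_cases hi' : β i = α i
    · congr 1; funext j
      by_cases hj : j = i
      · rw [hj, hi']
      · exact hαβ j hj
    · rw [← h]; congr 1; funext j
      by_cases hj : j = i
      · subst hj; simp only [flipAt_self]; revert hi'; cases β j <;> cases α j <;> simp
      · rw [flipAt_of_ne _ hj]; exact hαβ j hj
  · intro h
    refine ⟨⟨p, rfl⟩, fun i hi => ?_⟩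
    obtain ⟨α, hα, hs⟩ := h i hi
    exact ⟨flipAt α i, hα.flip hi, α, hα, fun j hj => flipAt_of_ne _ hj, hs⟩

lemma isRelevant_iff {f : BoolFun V} {i : V} : IsRelevant f i ↔ ∃ α, Sens f α i := by
  constructor
  · rintro ⟨α, -, β, -, hαβ, hne⟩
    by_contra! hcon
    have h := hcon α
    unfold Sens at h
    push Not at h
    refine hne ?_
    by_cases hi' : β i = α i
    · congr 1; funext j
      by_cases hj : j = i
      · rw [hj, hi']
      · exact hαβ j hj
    · rw [← h]; congr 1; funext j
      by_cases hj : j = i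
      · subst hj; simp only [flipAt_self]; revert hi'; cases β j <;> cases α j <;> simp
      · rw [flipAt_of_ne _ hj]; exact hαβ j hj
  · rintro ⟨α, h⟩
    exact ⟨flipAt α i, trivial, α, trivial, fun j hj => flipAt_of_ne _ hj, h⟩

/-- `A` is a module of `f`: `f` depends on the variables of `A` only through `h`. -/
def Fac (f : BoolFun V) (A : Finset V) (h : BoolFun V) : Prop :=
  DepOn h A ∧ ∀ α β, EqOff A α β → h α = h β → f α = f β

lemma Fac.trans {f e h : BoolFun V} {U A : Finset V} (hf : Fac f U e) (he : Fac e A h)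
    (hA : A ⊆ U) : Fac f A h :=
  ⟨he.1, fun α β hαβ hh => hf.2 α β (hαβ.mono hA) (he.2 α β hαβ hh)⟩

lemma Fac.sens_inner {f e : BoolFun V} {U : Finset V} (hf : Fac f U e) {α : V → Bool} {i : V}
    (hi : i ∈ U) (hs : Sens f α i) : Sens e α i :=
  fun h => hs (hf.2 _ _ (eqOff_flipAt hi α) h)

/-- On the subcube `U` through `α`, `f` is a function of the single bit `e`. It is not constant
there, so that function is injective. -/
lemma Fac.eq_iff {f e : BoolFun V} {U : Finset V} (hf : Fac f U e) {α β γ : V → Bool} {i : V}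
    (hi : i ∈ U) (hs : Sens f α i) (hβ : EqOff U β α) (hγ : EqOff U γ α) :
    f β = f γ ↔ e β = e γ := by
  refine ⟨fun h => ?_, fun h => hf.2 _ _ (hβ.trans hγ.symm) h⟩
  by_contra hne
  have hs' := hf.sens_inner hi hs
  have key : ∀ δ, EqOff U δ α → (e δ = e α → f δ = f α) ∧
      (e δ = e (flipAt α i) → f δ = f (flipAt α i)) := fun δ hδ =>
    ⟨hf.2 _ _ hδ, hf.2 _ _ (hδ.trans (eqOff_flipAt hi α).symm)⟩
  have h1 := key β hβ
  have h2 := key γ hγ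
  unfold Sens at hs hs'
  revert h1 h2 hs hs' h hne
  cases e β <;> cases e γ <;> cases e α <;> cases e (flipAt α i) <;> simp <;> grind

lemma Fac.sens_outer {f e : BoolFun V} {U : Finset V} (hf : Fac f U e) {α β : V → Bool}
    {i j : V} (hi : i ∈ U) (hs : Sens f α i) (hβ : EqOff U β α) (hj : j ∈ U)
    (hs' : Sens e β j) : Sens f β j :=
  fun h => hs' ((hf.eq_iff hi hs (hβ.flip hj) hβ).1 h)

/-- `α` on `U` and `β` elsewhere. -/
abbrev mix (U : Finset V) (α β : V → Bool) : V → Bool := U.piecewise α β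

lemma mix_mem {U : Finset V} {i : V} (hi : i ∈ U) (α β : V → Bool) : mix U α β i = α i :=
  Finset.piecewise_eq_of_mem _ _ _ hi

lemma mix_notMem {U : Finset V} {i : V} (hi : i ∉ U) (α β : V → Bool) : mix U α β i = β i :=
  Finset.piecewise_eq_of_notMem _ _ _ hi

lemma eqOff_mix (U : Finset V) (α β : V → Bool) : EqOff U (mix U α β) β :=
  fun _ hj => mix_notMem hj _ _

/-- Outside `U` the coordinates are frozen at a point where `f` reacts to a variable of `U`; there
`f` is `e` or its negation. -/
lemma Fac.sep_mix {f e : BoolFun V} {U S : Finset V} {p α : V → Bool} {i : V}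
    (hf : Fac f U e) (hS : S ⊆ U) (hi : i ∈ U) (hs : Sens f α i) (h : Sep e S p) :
    Sep f S (mix U p α) := by
  intro k hk
  obtain ⟨β, hβ, hsβ⟩ := h k hk
  refine ⟨mix U β α, fun j hj => ?_, hf.sens_outer hi hs (eqOff_mix _ _ _) (hS hk) ?_⟩
  · by_cases hjU : j ∈ U
    · rw [mix_mem hjU, mix_mem hjU]; exact hβ j hj
    · rw [mix_notMem hjU, mix_notMem hjU]
  · exact hf.1.sens hsβ fun j hj => mix_mem hj _ _

lemma Fac.sepIn {f e : BoolFun V} {U S W : Finset V} {p α : V → Bool} {i : V}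
    (hf : Fac f U e) (hS : S ⊆ U) (hα : EqOff W α p) (hi : i ∈ U) (hs : Sens f α i)
    (h : SepIn e S (W ∩ U) p) : SepIn f S W p := by
  obtain ⟨p', hp', hsep⟩ := h
  refine ⟨mix U p' α, fun j hj => ?_, hf.sep_mix hS hi hs hsep⟩
  by_cases hjU : j ∈ U
  · rw [mix_mem hjU]; exact hp' j (by simp [hj])
  · rw [mix_notMem hjU]; exact hα j hj

lemma Fac.sepEx {f e : BoolFun V} {U S : Finset V} (hf : Fac f U e) (hS : S ⊆ U)
    {α : V → Bool} {i : V} (hi : i ∈ U) (hs : Sens f α i) (h : SepEx e S) : SepEx f S :=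
  ⟨_, hf.sep_mix hS hi hs h.choose_spec⟩

lemma Fac.sep_inner {f e : BoolFun V} {U W : Finset V} {p : V → Bool} (hf : Fac f U e)
    (h : Sep f W p) : Sep e (W ∩ U) p := by
  intro k hk
  rw [Finset.mem_inter] at hk
  obtain ⟨α, hα, hs⟩ := h k hk.1
  refine ⟨mix U α p, fun j hj => ?_,
    hf.1.sens (hf.sens_inner hk.2 hs) fun j hj => mix_mem hj _ _⟩
  by_cases hjU : j ∈ U
  · rw [mix_mem hjU]; exact hα j fun hjW => hj (Finset.mem_inter.2 ⟨hjW, hjU⟩)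
  · rw [mix_notMem hjU]

/-- A hypercube of `f` for `W` induces one of `e` for `W ∩ U`, in which robustness finds a cube for
`S`. The coordinates outside `U` are then taken from a point of the `W`-cube where `f` is sensitive
inside `U`. -/
lemma Fac.robust {f e : BoolFun V} {U S : Finset V} (hf : Fac f U e) (hS : S ⊆ U)
    (hne : S.Nonempty) (h : Robust e S) : Robust f S := by
  intro W p hW hsep
  obtain ⟨i, hi⟩ := hne
  obtain ⟨α, hα, hs⟩ := hsep i (hW hi)
  exact hf.sepIn hS hα (hS hi) hs
    (h _ p (Finset.subset_inter hW hS) (hf.sep_inner hsep))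

/-- The set of relevant variables of `f`. -/
noncomputable def ess [Fintype V] (f : BoolFun V) : Finset V :=
  open Classical in Finset.univ.filter fun i => ∃ α, Sens f α i

lemma mem_ess [Fintype V] {f : BoolFun V} {i : V} : i ∈ ess f ↔ ∃ α, Sens f α i := by
  simp [ess]

lemma Sep.subset_ess [Fintype V] {f : BoolFun V} {S : Finset V} {p : V → Bool}
    (h : Sep f S p) : S ⊆ ess f := fun i hi => by
  obtain ⟨α, -, hs⟩ := h i hi
  exact mem_ess.2 ⟨α, hs⟩

lemma depOn_ess [Fintype V] (f : BoolFun V) : DepOn f (ess f) := by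
  intro α β hαβ
  -- Change `α` into `β` one coordinate at a time; only irrelevant coordinates ever change.
  have key : ∀ s : Finset V, f (mix s β α) = f α := by
    intro s
    induction s using Finset.induction_on with
    | empty => simp [mix]
    | insert i s hi ih =>
      rw [← ih]
      by_cases h : β i = α i
      · congr 1; funext j
        by_cases hj : j = i
        · subst hj; rw [mix_mem (by simp), mix_notMem hi, h]
        · by_cases hjs : j ∈ s
          · rw [mix_mem (by simp [hjs]), mix_mem hjs]
          · rw [mix_notMem (by simp [hjs, hj]), mix_notMem hjs]
      · have hie : i ∉ ess f := fun hie => h (hαβ i hie).symm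
        have hns : ¬ Sens f (mix s β α) i := fun hs => hie (mem_ess.2 ⟨_, hs⟩)
        unfold Sens at hns
        push Not at hns
        rw [← hns]
        congr 1; funext j
        by_cases hj : j = i
        · subst hj; rw [mix_mem (by simp), flipAt_self, mix_notMem hi]
          revert h; cases β j <;> cases α j <;> simp
        · rw [flipAt_of_ne _ hj]
          by_cases hjs : j ∈ s
          · rw [mix_mem (by simp [hjs]), mix_mem hjs]
          · rw [mix_notMem (by simp [hjs, hj]), mix_notMem hjs]
  rw [← key Finset.univ]
  simp [mix]

lemma DepOn.ess_subset [Fintype V] {f : BoolFun V} {U : Finset V} (h : DepOn f U) :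
    ess f ⊆ U := fun _ hi => h.mem (mem_ess.1 hi).choose_spec

lemma DepOn.sep {f : BoolFun V} {U : Finset V} (h : DepOn f U)
    (hr : ∀ i ∈ U, ∃ α, Sens f α i) (p : V → Bool) : Sep f U p := by
  intro i hi
  obtain ⟨α, hα⟩ := hr i hi
  exact ⟨mix U α p, eqOff_mix _ _ _, h.sens hα fun j hj => mix_mem hj _ _⟩

lemma sep_ess [Fintype V] (f : BoolFun V) (p : V → Bool) : Sep f (ess f) p :=
  (depOn_ess f).sep (fun _ hi => mem_ess.1 hi) p

/-- The restriction of `f` obtained by fixing variable `j` to `c`. -/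
def fixVar (f : BoolFun V) (j : V) (c : Bool) : BoolFun V :=
  fun α => f (Function.update α j c)

lemma flipAt_update {i j : V} (hij : i ≠ j) (α : V → Bool) (c : Bool) :
    flipAt (Function.update α j c) i = Function.update (flipAt α i) j c := by
  funext k
  by_cases hk : k = j
  · subst hk; rw [flipAt_of_ne _ hij.symm]; simp
  · by_cases hki : k = i
    · subst hki; simp [hk]
    · simp [hk, flipAt_of_ne _ hki]

lemma sens_fixVar {f : BoolFun V} {i j : V} {c : Bool} {α : V → Bool} :
    Sens (fixVar f j c) α i ↔ i ≠ j ∧ Sens f (Function.update α j c) i := by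
  by_cases hij : i = j
  · subst hij
    simp only [ne_eq, not_true, false_and, iff_false]
    intro h
    apply h
    simp only [fixVar]
    congr 1
    funext k
    by_cases hk : k = i
    · subst hk; simp
    · simp [hk, flipAt_of_ne _ hk]
  · simp only [ne_eq, hij, not_false_eq_true, true_and]
    unfold Sens fixVar
    rw [flipAt_update hij]

lemma sens_update_eq {f : BoolFun V} {α : V → Bool} {i j : V} (hij : i ≠ j)
    (h : Sens f α i) : Sens (fixVar f j (α j)) α i := by
  rw [sens_fixVar]
  exact ⟨hij, by simpa using h⟩

lemma Sep.fixVar {f : BoolFun V} {S : Finset V} {p : V → Bool} (h : Sep f S p) {j : V}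
    (hj : j ∉ S) : Sep (fixVar f j (p j)) S p := by
  intro i hi
  obtain ⟨α, hα, hs⟩ := h i hi
  refine ⟨α, hα, ?_⟩
  rw [← hα j hj]
  exact sens_update_eq (fun h => hj (h ▸ hi)) hs

lemma SepEx.of_fixVar {f : BoolFun V} {S : Finset V} {j : V} {c : Bool}
    (h : SepEx (CheckingTest.fixVar f j c) S) : SepEx f S := by
  obtain ⟨p, hp⟩ := h
  refine ⟨Function.update p j c, fun i hi => ?_⟩
  obtain ⟨α, hα, hs⟩ := hp i hi
  rw [sens_fixVar] at hs
  refine ⟨_, fun k hk => ?_, hs.2⟩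
  by_cases hkj : k = j
  · subst hkj; simp
  · simp [hkj, hα k hk]

/-- Among the substitutions outside `S` that keep a hypercube for `S`, take one with the most
relevant variables left. If `j := c` also killed some `i ≠ j`, then fixing `i` at its value in a
point sensitive to `j` would keep everything that survived `j := c`, and keep `j` as well,
contradicting maximality. -/
lemma exists_fixVar_ess [Fintype V] {f : BoolFun V} {S : Finset V} (hS : SepEx f S)
    (hne : S ≠ ess f) : ∃ j ∈ ess f, j ∉ S ∧ ∃ c, SepEx (fixVar f j c) S ∧
      ess (fixVar f j c) = (ess f).erase j := by
  classical
  obtain ⟨p, hp⟩ := hS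
  have hSe := hp.subset_ess
  let P : Finset (V × Bool) := Finset.univ.filter fun x => x.1 ∈ ess f ∧ x.1 ∉ S ∧
    SepEx (fixVar f x.1 x.2) S
  have hP : P.Nonempty := by
    obtain ⟨j, hj, hjS⟩ : ∃ j ∈ ess f, j ∉ S := by
      by_contra! h
      exact hne (Finset.Subset.antisymm hSe h)
    exact ⟨(j, p j), by simp only [P, Finset.mem_filter]; exact
      ⟨Finset.mem_univ _, hj, hjS, p, hp.fixVar hjS⟩⟩
  obtain ⟨⟨j, c⟩, hjP, hmax⟩ := Finset.exists_max_image P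
    (fun x => (ess (fixVar f x.1 x.2)).card) hP
  simp only [P, Finset.mem_filter, Finset.mem_univ, true_and] at hjP hmax
  obtain ⟨hj, hjS, hsep⟩ := hjP
  refine ⟨j, hj, hjS, c, hsep, ?_⟩
  have hsub : ess (fixVar f j c) ⊆ (ess f).erase j := by
    intro i hi
    obtain ⟨α, hα⟩ := mem_ess.1 hi
    rw [sens_fixVar] at hα
    exact Finset.mem_erase.2 ⟨hα.1, mem_ess.2 ⟨_, hα.2⟩⟩
  refine Finset.Subset.antisymm hsub fun i hi => ?_
  by_contra hie
  rw [Finset.mem_erase] at hi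
  obtain ⟨hij, hi⟩ := hi
  obtain ⟨q, hq⟩ := hsep
  have hiS : i ∉ S := fun h => hie (hq.subset_ess h)
  obtain ⟨α, hα⟩ := mem_ess.1 hj
  -- relevant variables of the first restriction are relevant in the second
  have hins : ∀ β d, f (Function.update (Function.update β i d) j c) =
      f (Function.update β j c) := fun β d => by
    have := depOn_ess (fixVar f j c) (Function.update β i d) β fun k hk => by
      have : k ≠ i := fun h => hie (h ▸ hk)
      simp [this]
    exact this
  have htrans : ∀ β k, Sens (fixVar f j c) β k →
      Sens (fixVar f i (α i)) (Function.update β j c) k := by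
    intro β k hk
    have hki : k ≠ i := fun h => hie (h ▸ mem_ess.2 ⟨_, hk⟩)
    have hk' : Sens (fixVar f j c) (Function.update β i (α i)) k :=
      (depOn_ess _).sens hk fun m hm => by
        have : m ≠ i := fun h => hie (h ▸ hm)
        simp [this]
    rw [sens_fixVar] at hk' ⊢
    refine ⟨hki, ?_⟩
    rw [Function.update_comm (Ne.symm hij)]
    exact hk'.2
  have hsep2 : SepEx (fixVar f i (α i)) S := by
    refine ⟨Function.update q j c, fun k hk => ?_⟩
    obtain ⟨β, hβ, hs⟩ := hq k hk
    refine ⟨_, fun m hm => ?_, htrans β k hs⟩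
    by_cases hmj : m = j
    · subst hmj; simp
    · simp [hmj, hβ m hm]
  have hle := hmax (i, α i) ⟨hi, hiS, hsep2⟩
  have hss : insert j (ess (fixVar f j c)) ⊆ ess (fixVar f i (α i)) := by
    intro k hk
    rw [Finset.mem_insert] at hk
    rcases hk with rfl | hk
    · exact mem_ess.2 ⟨α, sens_update_eq (Ne.symm hij) hα⟩
    · obtain ⟨β, hβ⟩ := mem_ess.1 hk
      exact mem_ess.2 ⟨_, htrans β k hβ⟩
  have hjn : j ∉ ess (fixVar f j c) := fun h => by simpa using hsub h
  have := Finset.card_le_card hss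
  rw [Finset.card_insert_of_notMem hjn] at this
  simp only at hle
  omega

/-- Each substitution from `exists_fixVar_ess` loses exactly one relevant variable, so at some stage
exactly `m` remain. The set of all relevant variables of a function always has a relevance
hypercube. -/
lemma SepEx.extend [Fintype V] {f : BoolFun V} {S : Finset V} (hS : SepEx f S) {m : ℕ}
    (h1 : S.card ≤ m) (h2 : m ≤ (ess f).card) : ∃ W, S ⊆ W ∧ W.card = m ∧ SepEx f W := by
  obtain ⟨n, hn⟩ : ∃ n, (ess f).card = n := ⟨_, rfl⟩
  induction n generalizing f with
  | zero =>
    exact ⟨ess f, hS.choose_spec.subset_ess, by omega, fun _ => false, sep_ess f _⟩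
  | succ n ih =>
    by_cases hm : m = n + 1
    · exact ⟨ess f, hS.choose_spec.subset_ess, by omega, fun _ => false, sep_ess f _⟩
    · have hne : S ≠ ess f := fun h => by have := congrArg Finset.card h; omega
      obtain ⟨j, hj, -, c, hsep, hess⟩ := exists_fixVar_ess hS hne
      have hc : (ess (fixVar f j c)).card = n := by
        rw [hess, Finset.card_erase_of_mem hj]; omega
      obtain ⟨W, hSW, hW, hWs⟩ := ih hsep (by rw [hc]; omega) hc
      exact ⟨W, hSW, hW, hWs.of_fixVar⟩

end Basics

end CheckingTest
namespace CheckingTest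

/-! ### Compositions over disjoint branches, and their transversals. -/

section Nodes

set_option linter.unusedSectionVars false

variable {V : Type*} [DecidableEq V]

/-- The composition of `q` with the functions `e x`, substituted for the variables `x`. -/
def comp (q : BoolFun V) (e : V → BoolFun V) : BoolFun V := fun α => q fun x => e x α

/-- A node of a read-once formula: the function `q` depends exactly on the labels `K`, and the
functions `e x`, for `x ∈ K`, depend exactly on the pairwise disjoint nonempty sets `U x`. -/
structure Node (K : Finset V) (q : BoolFun V) (e : V → BoolFun V) (U : V → Finset V) :
    Prop where
  dep : DepOn q K
  rel : ∀ x ∈ K, ∃ z, Sens q z x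
  edep : ∀ x ∈ K, DepOn (e x) (U x)
  erel : ∀ x ∈ K, ∀ i ∈ U x, ∃ α, Sens (e x) α i
  ne : ∀ x ∈ K, (U x).Nonempty
  disj : ∀ x ∈ K, ∀ y ∈ K, x ≠ y → Disjoint (U x) (U y)

namespace Node

variable {K : Finset V} {q : BoolFun V} {e : V → BoolFun V} {U : V → Finset V}

lemma eq_of_mem (N : Node K q e U) {x y i : V} (hx : x ∈ K) (hy : y ∈ K) (hix : i ∈ U x)
    (hiy : i ∈ U y) : x = y := by
  by_contra h
  exact Finset.disjoint_left.1 (N.disj x hx y hy h) hix hiy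

lemma fac (N : Node K q e U) {x : V} (hx : x ∈ K) : Fac (comp q e) (U x) (e x) := by
  refine ⟨N.edep x hx, fun α β hαβ h => N.dep _ _ fun y hy => ?_⟩
  by_cases hxy : y = x
  · subst hxy; exact h
  · exact N.edep y hy _ _ fun i hi =>
      hαβ i fun hix => hxy (N.eq_of_mem hy hx hi hix)

lemma depOn (N : Node K q e U) : DepOn (comp q e) (K.biUnion U) := fun _ _ hαβ =>
  N.dep _ _ fun x hx => N.edep x hx _ _ fun i hi => hαβ i (Finset.mem_biUnion.2 ⟨x, hx, hi⟩)

lemma subset (_N : Node K q e U) {x : V} (hx : x ∈ K) : U x ⊆ K.biUnion U :=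
  Finset.subset_biUnion_of_mem U hx

/-- A Boolean chain rule: flipping `i` moves at most the one argument `x` of `q`. -/
lemma sens_iff (N : Node K q e U) {x i : V} (hx : x ∈ K) (hi : i ∈ U x) {α : V → Bool} :
    Sens (comp q e) α i ↔ Sens q (fun y => e y α) x ∧ Sens (e x) α i := by
  have hoff : ∀ y ∈ K, y ≠ x → e y (flipAt α i) = e y α := fun y hy hyx =>
    N.edep y hy _ _ fun j hj => flipAt_of_ne _ fun h =>
      hyx (N.eq_of_mem hy hx (h ▸ hj) hi)
  by_cases hs : Sens (e x) α i
  · simp only [hs, and_true]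
    unfold Sens comp
    rw [N.dep (fun y => e y (flipAt α i)) (flipAt (fun y => e y α) x)]
    intro y hy
    by_cases hyx : y = x
    · subst hyx
      unfold Sens at hs
      simp only [flipAt_self]
      revert hs; cases e y (flipAt α i) <;> cases e y α <;> simp
    · rw [flipAt_of_ne _ hyx]; exact hoff y hy hyx
  · simp only [hs, and_false, iff_false]
    exact fun h => hs ((N.fac hx).sens_inner hi h)

lemma exists_owner (N : Node K q e U) : ∃ own : V → V, ∀ x ∈ K, ∀ i ∈ U x, own i = x := by
  classical
  refine ⟨fun i => if h : ∃ x ∈ K, i ∈ U x then h.choose else i, fun x hx i hi => ?_⟩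
  have h : ∃ x ∈ K, i ∈ U x := ⟨x, hx, hi⟩
  simp only [h, dif_pos]
  exact N.eq_of_mem h.choose_spec.1 hx h.choose_spec.2 hi

/-- Disjointness allows the branches to be prescribed independently. -/
lemma combine (N : Node K q e U) (β : V → V → Bool) (p : V → Bool) :
    ∃ γ : V → Bool, (∀ x ∈ K, ∀ i ∈ U x, γ i = β x i) ∧ ∀ i, i ∉ K.biUnion U → γ i = p i := by
  classical
  obtain ⟨own, hown⟩ := N.exists_owner
  refine ⟨fun i => if i ∈ K.biUnion U then β (own i) i else p i, fun x hx i hi => ?_,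
    fun i hi => by simp only [hi, if_false]⟩
  simp only [if_pos (N.subset hx hi), hown x hx i hi]

lemma rel_comp (N : Node K q e U) {i : V} (hi : i ∈ K.biUnion U) :
    ∃ α, Sens (comp q e) α i := by
  obtain ⟨x, hx, hix⟩ := Finset.mem_biUnion.1 hi
  obtain ⟨z, hz⟩ := N.rel x hx
  obtain ⟨α, hα⟩ := N.erel x hx i hix
  have : ∀ y, ∃ β, y ∈ K → y ≠ x → e y β = z y := fun y => by
    by_cases hy : y ∈ K
    · obtain ⟨j, hj⟩ := N.ne y hy
      obtain ⟨δ, hδ⟩ := N.erel y hy j hj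
      obtain ⟨β, -, hβ⟩ := hδ.exists_value (z y)
      exact ⟨β, fun _ _ => hβ⟩
    · exact ⟨z, fun h => absurd h hy⟩
  choose β hβ using this
  obtain ⟨γ, hγ, -⟩ := N.combine (Function.update β x α) z
  refine ⟨γ, (N.sens_iff hx hix).2 ⟨?_, ?_⟩⟩
  · have h1 : Sens q (fun y => if y = x then e x γ else z y) x :=
      hz.of_eqOff_single fun y hy => by
        have : y ≠ x := by simpa using hy
        simp [this]
    refine N.dep.sens h1 fun y hy => ?_
    by_cases hyx : y = x
    · simp [hyx]
    · simp only [hyx, if_false]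
      rw [← hβ y hy hyx]
      exact N.edep y hy _ _ fun j hj => by rw [hγ y hy j hj, Function.update_of_ne hyx]
  · exact (N.edep x hx).sens hα fun j hj => by rw [hγ x hx j hj, Function.update_self]

/-- Branches outside `J` are held at the values `c` demanded by the cube of `q`. A branch in `J` has
a nonempty hypercube of its own, hence attains both values on it, so every vector of the `J`-cube of
`q` is realized. Sensitivity then follows from `sens_iff`. -/
lemma sepIn (N : Node K q e U) {J S W : Finset V} {c p : V → Bool}
    (hq : Sep q J c) (hS : S ⊆ K.biUnion U)
    (hJ : ∀ x ∈ J, (S ∩ U x).Nonempty ∧ SepIn (e x) (S ∩ U x) (W ∩ U x) p)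
    (hJ' : ∀ x ∈ K, x ∉ J → S ∩ U x = ∅ ∧ ∃ p', EqOff (W ∩ U x) p' p ∧ e x p' = c x) :
    SepIn (comp q e) S W p := by
  have h1 : ∀ x, ∃ p', x ∈ K → EqOff (W ∩ U x) p' p ∧ (x ∈ J → Sep (e x) (S ∩ U x) p') ∧
      (x ∉ J → e x p' = c x) := fun x => by
    by_cases hx : x ∈ K
    · by_cases hxJ : x ∈ J
      · obtain ⟨p', h, h'⟩ := (hJ x hxJ).2
        exact ⟨p', fun _ => ⟨h, fun _ => h', fun h => absurd hxJ h⟩⟩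
      · obtain ⟨p', h, h'⟩ := (hJ' x hx hxJ).2
        exact ⟨p', fun _ => ⟨h, fun h => absurd h hxJ, fun _ => h'⟩⟩
    · exact ⟨p, fun h => absurd h hx⟩
  choose P hP using h1
  obtain ⟨p', hp', hp'off⟩ := N.combine P p
  refine ⟨p', fun j hj => ?_, fun k hk => ?_⟩
  · by_cases hjU : j ∈ K.biUnion U
    · obtain ⟨x, hx, hjx⟩ := Finset.mem_biUnion.1 hjU
      rw [hp' x hx j hjx]
      exact (hP x hx).1 j (by simp [hj])
    · exact hp'off j hjU
  · obtain ⟨x, hx, hkx⟩ := Finset.mem_biUnion.1 (hS hk)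
    have hxJ : x ∈ J := by
      by_contra hxJ
      have := (hJ' x hx hxJ).1
      exact absurd (Finset.mem_inter.2 ⟨hk, hkx⟩) (by simp [this])
    obtain ⟨z, hz, hzs⟩ := hq x hxJ
    have h2 : ∀ y, ∃ β, y ∈ K → EqOff (S ∩ U y) β (P y) ∧ (y ≠ x → e y β = z y) ∧
        (y = x → Sens (e y) β k) := fun y => by
      by_cases hy : y ∈ K
      · by_cases hyx : y = x
        · subst hyx
          obtain ⟨β, hβ, hs⟩ := (hP y hy).2.1 hxJ k (Finset.mem_inter.2 ⟨hk, hkx⟩)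
          exact ⟨β, fun _ => ⟨hβ, fun h => absurd rfl h, fun _ => hs⟩⟩
        · by_cases hyJ : y ∈ J
          · obtain ⟨j, hj⟩ := (hJ y hyJ).1
            obtain ⟨δ, hδ, hs⟩ := (hP y hy).2.1 hyJ j hj
            obtain ⟨β, hβ, hβz⟩ := hs.exists_value (z y)
            exact ⟨β, fun _ => ⟨(hβ.mono (by simpa using hj)).trans hδ, fun _ => hβz,
              fun h => absurd h hyx⟩⟩
          · exact ⟨P y, fun _ => ⟨EqOff.refl _ _, fun _ => by
              rw [(hP y hy).2.2 hyJ, hz y hyJ], fun h => absurd h hyx⟩⟩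
      · exact ⟨p, fun h => absurd h hy⟩
    choose β hβ using h2
    obtain ⟨γ, hγ, hγoff⟩ := N.combine β p
    have heγ : ∀ y ∈ K, e y γ = e y (β y) := fun y hy =>
      N.edep y hy _ _ fun j hj => hγ y hy j hj
    refine ⟨γ, fun j hj => ?_, (N.sens_iff hx hkx).2 ⟨?_, ?_⟩⟩
    · by_cases hjU : j ∈ K.biUnion U
      · obtain ⟨y, hy, hjy⟩ := Finset.mem_biUnion.1 hjU
        rw [hγ y hy j hjy, hp' y hy j hjy]
        exact (hβ y hy).1 j (by simp [hj])
      · rw [hγoff j hjU, hp'off j hjU]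
    · have h1 : Sens q (fun y => if y = x then e x γ else z y) x :=
        hzs.of_eqOff_single fun y hy => by
          have : y ≠ x := by simpa using hy
          simp [this]
      refine N.dep.sens h1 fun y hy => ?_
      by_cases hyx : y = x
      · simp [hyx]
      · simp only [hyx, if_false]
        rw [heγ y hy, (hβ y hy).2.1 hyx]
    · exact (N.edep x hx).sens ((hβ x hx).2.2 rfl) fun j hj => hγ x hx j hj

lemma sep_q (N : Node K q e U) (c : V → Bool) : Sep q K c := DepOn.sep N.dep N.rel c

/-- A set meeting every branch of a node in a robust set is robust. -/
lemma robust (N : Node K q e U) {S : Finset V} (hS : S ⊆ K.biUnion U)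
    (h : ∀ x ∈ K, (S ∩ U x).Nonempty ∧ Robust (e x) (S ∩ U x)) : Robust (comp q e) S := by
  intro W p hSW hsep
  refine N.sepIn (N.sep_q p) hS (fun x hx => ⟨(h x hx).1, ?_⟩)
    fun x hx hx' => absurd hx hx'
  exact (h x hx).2 _ _ (Finset.inter_subset_inter hSW (Finset.Subset.refl _))
    ((N.fac hx).sep_inner hsep)

lemma sepEx (N : Node K q e U) [Fintype V] {J S : Finset V} (hJK : J ⊆ K)
    (hq : SepEx q J) (hS : S ⊆ K.biUnion U)
    (hJ : ∀ x ∈ J, (S ∩ U x).Nonempty ∧ SepEx (e x) (S ∩ U x))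
    (hJ' : ∀ x ∈ K, x ∉ J → S ∩ U x = ∅) : SepEx (comp q e) S := by
  obtain ⟨c, hc⟩ := hq
  refine (N.sepIn (W := Finset.univ) (p := c) hc hS (fun x hx => ⟨(hJ x hx).1, ?_⟩)
    fun x hx hxJ => ⟨hJ' x hx hxJ, ?_⟩).sepEx
  · obtain ⟨p, hp⟩ := (hJ x hx).2
    refine ⟨mix (U x) p c, by simpa using eqOff_mix _ _ _, fun k hk => ?_⟩
    obtain ⟨α, hα, hs⟩ := hp k hk
    refine ⟨mix (U x) α c, fun j hj => ?_,
      (N.edep x (hJK hx)).sens hs fun j hj => mix_mem hj _ _⟩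
    by_cases hjU : j ∈ U x
    · rw [mix_mem hjU, mix_mem hjU]; exact hα j hj
    · rw [mix_notMem hjU, mix_notMem hjU]
  · obtain ⟨j, hj⟩ := N.ne x hx
    obtain ⟨δ, hδ⟩ := N.erel x hx j hj
    obtain ⟨β, -, hβ⟩ := hδ.exists_value (c x)
    refine ⟨mix (U x) β c, by simpa using eqOff_mix _ _ _, ?_⟩
    rw [← hβ]
    exact N.edep x hx _ _ fun j hj => mix_mem hj _ _

end Node

/-- Only `t` among the variables of `e` moves in the cube, so `e` is there a nonconstant function of
one bit. -/
lemma literal_on_subcube {e : BoolFun V} {U T : Finset V} {p : V → Bool} {t : V}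
    (he : DepOn e U) (hT : ∀ i ∈ T, i ∈ U → i = t)
    (hs : ∃ α, EqOff T α p ∧ Sens e α t) :
    ∃ s, ∀ β, EqOff T β p → e β = xor (β t) s := by
  obtain ⟨α, hα, hs⟩ := hs
  refine ⟨xor (e α) (α t), fun β hβ => ?_⟩
  have hU : ∀ j ∈ U, j ≠ t → β j = α j := fun j hj hjt => by
    have : j ∉ T := fun h => hjt (hT j h hj)
    rw [hβ j this, hα j this]
  by_cases h : β t = α t
  · have : e β = e α := he _ _ fun j hj => by
      by_cases hjt : j = t
      · rw [hjt, h]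
      · exact hU j hj hjt
    rw [this, h]; cases e α <;> cases α t <;> rfl
  · have : e β = e (flipAt α t) := he _ _ fun j hj => by
      by_cases hjt : j = t
      · subst hjt; rw [flipAt_self]; revert h; cases β j <;> cases α j <;> simp
      · rw [flipAt_of_ne _ hjt]; exact hU j hj hjt
    rw [this]
    unfold Sens at hs
    revert hs h
    cases e α <;> cases α t <;> cases e (flipAt α t) <;> cases β t <;> simp

namespace Node

variable {K : Finset V} {q : BoolFun V} {e : V → BoolFun V} {U : V → Finset V}

/-- The shape of a node on a subcube having at most one free variable `τ x` in each branch. -/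
lemma realize (N : Node K q e U) {τ : V → V} (hτ : ∀ x ∈ K, τ x ∈ U x) {J T : Finset V}
    {p : V → Bool} (hJ : J ⊆ K) (hT : ∀ x ∈ K, ∀ i ∈ T, i ∈ U x → x ∈ J ∧ i = τ x)
    (hJT : ∀ x ∈ J, τ x ∈ T)
    (hs : ∀ x ∈ J, ∃ α, EqOff T α p ∧ Sens (comp q e) α (τ x)) :
    ∃ s : V → Bool, (∀ α, EqOff T α p → ∀ x ∈ J, e x α = xor (α (τ x)) (s x)) ∧
      (∀ α, EqOff T α p → ∀ x ∈ K, x ∉ J → e x α = e x p) ∧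
      Sep q J (fun x => e x p) ∧
      ∀ z γ : V → Bool, EqOff T γ p → ∃ α, EqOff T α p ∧ (∀ i, i ∉ J.image τ → α i = γ i) ∧
        ∀ x ∈ J, e x α = z x := by
  classical
  have h1 : ∀ x, ∃ s, x ∈ J → ∀ α, EqOff T α p → e x α = xor (α (τ x)) s := fun x => by
    by_cases hx : x ∈ J
    · obtain ⟨α, hα, hs⟩ := hs x hx
      obtain ⟨s, h⟩ := literal_on_subcube (N.edep x (hJ hx)) (T := T) (p := p) (t := τ x)
        (fun i hi hiU => (hT x (hJ hx) i hi hiU).2)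
        ⟨α, hα, (N.fac (hJ hx)).sens_inner (hτ x (hJ hx)) hs⟩
      exact ⟨s, fun _ => h⟩
    · exact ⟨false, fun h => absurd h hx⟩
  choose s hs' using h1
  have hconst : ∀ α, EqOff T α p → ∀ x ∈ K, x ∉ J → e x α = e x p := fun α hα x hx hxJ =>
    N.edep x hx _ _ fun i hi => hα i fun hiT => hxJ (hT x hx i hiT hi).1
  refine ⟨s, fun α hα x hx => hs' x hx α hα, hconst, fun x hx => ?_, fun z γ hγ => ?_⟩
  · obtain ⟨α, hα, h⟩ := hs x hx
    have h := ((N.sens_iff (hJ hx) (hτ x (hJ hx))).1 h).1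
    refine ⟨fun y => if y ∈ K then e y α else e y p, fun y hy => ?_,
      N.dep.sens h fun y hy => by simp [hy]⟩
    by_cases hyK : y ∈ K
    · simp only [hyK, if_true]; exact hconst α hα y hyK hy
    · simp only [hyK, if_false]
  · obtain ⟨own, hown⟩ := N.exists_owner
    have hα : EqOff T (fun i => if i ∈ J.image τ then xor (z (own i)) (s (own i)) else γ i) p := by
      intro i hi
      have : i ∉ J.image τ := fun h => by
        obtain ⟨x, hx, rfl⟩ := Finset.mem_image.1 h
        exact hi (hJT x hx)
      simp only [this, if_false]; exact hγ i hi
    refine ⟨_, hα, fun i hi => by simp only [hi, if_false], fun x hx => ?_⟩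
    rw [hs' x hx _ hα]
    have : τ x ∈ J.image τ := Finset.mem_image_of_mem _ hx
    simp only [this, if_true]
    rw [hown x (hJ hx) _ (hτ x (hJ hx))]
    cases z x <;> cases s x <;> rfl

lemma image_inter (N : Node K q e U) {τ : V → V} (hτ : ∀ x ∈ K, τ x ∈ U x) {J : Finset V}
    (hJ : J ⊆ K) {x : V} (hx : x ∈ J) : J.image τ ∩ U x = {τ x} := by
  ext i
  simp only [Finset.mem_inter, Finset.mem_image, Finset.mem_singleton]
  constructor
  · rintro ⟨⟨y, hy, rfl⟩, h⟩
    rw [N.eq_of_mem (hJ hy) (hJ hx) (hτ y (hJ hy)) h]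
  · rintro rfl
    exact ⟨⟨x, hx, rfl⟩, hτ x (hJ hx)⟩

lemma image_inter_empty (N : Node K q e U) {τ : V → V} (hτ : ∀ x ∈ K, τ x ∈ U x)
    {J : Finset V} (hJ : J ⊆ K) {x : V} (hx : x ∈ K) (hxJ : x ∉ J) :
    J.image τ ∩ U x = ∅ := by
  ext i
  simp only [Finset.mem_inter, Finset.mem_image, Finset.notMem_empty, iff_false]
  rintro ⟨⟨y, hy, rfl⟩, h⟩
  exact hxJ (N.eq_of_mem (hJ hy) hx (hτ y (hJ hy)) h ▸ hy)

lemma image_subset (N : Node K q e U) {τ : V → V} (hτ : ∀ x ∈ K, τ x ∈ U x)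
    {J : Finset V} (hJ : J ⊆ K) : J.image τ ⊆ K.biUnion U := by
  intro i hi
  obtain ⟨x, hx, rfl⟩ := Finset.mem_image.1 hi
  exact N.subset (hJ hx) (hτ x (hJ hx))

lemma card_image (N : Node K q e U) {τ : V → V} (hτ : ∀ x ∈ K, τ x ∈ U x)
    {J : Finset V} (hJ : J ⊆ K) : (J.image τ).card = J.card :=
  Finset.card_image_of_injOn fun x hx y hy h =>
    N.eq_of_mem (hJ hx) (hJ hy) (hτ x (hJ hx)) (by
      have := hτ y (hJ hy); rwa [← h] at this)

/-- The basic supply of robust sets: a transversal meets every branch in a singleton, and singletons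
are robust. -/
lemma robust_image (N : Node K q e U) {τ : V → V} (hτ : ∀ x ∈ K, τ x ∈ U x) :
    Robust (comp q e) (K.image τ) := by
  refine N.robust (N.image_subset hτ (Finset.Subset.refl _)) fun x hx => ?_
  rw [N.image_inter hτ (Finset.Subset.refl _) hx]
  exact ⟨by simp, robust_singleton _ _⟩

lemma sepEx_image [Fintype V] (N : Node K q e U) {τ : V → V} (hτ : ∀ x ∈ K, τ x ∈ U x)
    {J : Finset V} (hJ : J ⊆ K) (hq : SepEx q J) : SepEx (comp q e) (J.image τ) := by
  refine N.sepEx hJ hq (N.image_subset hτ hJ) (fun x hx => ?_) fun x hx hxJ =>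
    N.image_inter_empty hτ hJ hx hxJ
  rw [N.image_inter hτ hJ hx]
  obtain ⟨α, hα⟩ := N.erel x (hJ hx) _ (hτ x (hJ hx))
  exact ⟨by simp, α, sep_singleton hα⟩

end Node

end Nodes

end CheckingTest
namespace CheckingTest

/-! ### Normal form of read-once functions: trees with binary or prime nodes. -/

section ReadOnce

set_option linter.unusedSectionVars false

variable {V : Type*} [DecidableEq V]

/-- `q` has no modules in `K` other than singletons and `K` itself. -/
def Prim (q : BoolFun V) (K : Finset V) : Prop :=
  ∀ A ⊆ K, ∀ h, Fac q A h → A.card ≤ 1 ∨ A = K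

/-- Normalized read-once functions over `B_l`, with their sets of variables: the inner nodes of
the formula are labelled by binary or prime functions. -/
inductive RO (l : ℕ) : BoolFun V → Finset V → Prop
  | leaf (x : V) (s : Bool) : RO l (fun α => xor (α x) s) {x}
  | node (K : Finset V) (q : BoolFun V) (e : V → BoolFun V) (U : V → Finset V)
      (N : Node K q e U) (h2 : 2 ≤ K.card) (hl : K.card ≤ l) (hp : K.card = 2 ∨ Prim q K)
      (he : ∀ x ∈ K, RO l (e x) (U x)) : RO l (comp q e) (K.biUnion U)

lemma sens_leaf (x : V) (s : Bool) (α : V → Bool) : Sens (fun α => xor (α x) s) α x := by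
  simp only [Sens, flipAt_self]; cases α x <;> simp

lemma RO.depOn {l : ℕ} {e : BoolFun V} {U : Finset V} (h : RO l e U) : DepOn e U := by
  cases h with
  | leaf x s => exact fun α β h => by simp only [h x (by simp)]
  | node K q e U N => exact N.depOn

lemma RO.rel {l : ℕ} {e : BoolFun V} {U : Finset V} (h : RO l e U) :
    ∀ i ∈ U, ∃ α, Sens e α i := by
  cases h with
  | leaf x s =>
    intro i hi
    rw [Finset.mem_singleton] at hi
    subst hi
    exact ⟨fun _ => false, sens_leaf _ _ _⟩
  | node K q e U N => exact fun i hi => N.rel_comp hi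

lemma RO.nonempty {l : ℕ} {e : BoolFun V} {U : Finset V} (h : RO l e U) : U.Nonempty := by
  cases h with
  | leaf x s => simp
  | node K q e U N h2 =>
    have hK : K.Nonempty := Finset.card_pos.1 (by omega)
    obtain ⟨x, hx⟩ := hK
    exact (N.ne x hx).mono (N.subset hx)

lemma RO.ess_eq [Fintype V] {l : ℕ} {e : BoolFun V} {U : Finset V} (h : RO l e U) :
    ess e = U :=
  Finset.Subset.antisymm h.depOn.ess_subset fun i hi => mem_ess.2 (h.rel i hi)

lemma not_inj (a b : Bool) : (!a) = (!b) ↔ a = b := by cases a <;> cases b <;> simp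

lemma RO.neg {l : ℕ} {e : BoolFun V} {U : Finset V} (h : RO l e U) :
    RO l (fun α => !e α) U := by
  cases h with
  | leaf x s =>
    have : (fun α : V → Bool => !(xor (α x) s)) = fun α => xor (α x) (!s) := by
      funext α; cases α x <;> cases s <;> rfl
    rw [this]; exact RO.leaf x _
  | node K q e U N h2 hl hp he =>
    have hs : ∀ z x, Sens (fun z => !q z) z x ↔ Sens q z x := fun z x => by
      unfold Sens; rw [ne_eq, not_inj]
    refine RO.node K (fun z => !q z) e U
      ⟨fun α β h => congrArg _ (N.dep α β h), fun x hx => ?_, N.edep, N.erel, N.ne, N.disj⟩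
      h2 hl (hp.imp id fun hp A hA h hF => hp A hA h
        ⟨hF.1, fun α β h1 h2 => (not_inj _ _).1 (hF.2 α β h1 h2)⟩) he
    obtain ⟨z, hz⟩ := N.rel x hx
    exact ⟨z, (hs z x).2 hz⟩

lemma RO.xor_right {l : ℕ} {e : BoolFun V} {U : Finset V} (h : RO l e U) (s : Bool) :
    RO l (fun α => Bool.xor (e α) s) U := by
  cases s
  · simpa using h
  · simpa using h.neg

lemma mix_flipAt_notMem {U : Finset V} {i : V} (hi : i ∉ U) (α β : V → Bool) :
    mix U α (flipAt β i) = flipAt (mix U α β) i := by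
  funext j
  by_cases hj : j ∈ U
  · rw [flipAt_of_ne _ (fun h : j = i => hi (h ▸ hj)), mix_mem hj, mix_mem hj]
  · by_cases hji : j = i
    · subst hji; rw [mix_notMem hj, flipAt_self, flipAt_self, mix_notMem hj]
    · rw [flipAt_of_ne _ hji, mix_notMem hj, mix_notMem hj, flipAt_of_ne _ hji]

lemma mix_flipAt_mem {U : Finset V} {i : V} (hi : i ∈ U) (α β : V → Bool) :
    mix U α (flipAt β i) = mix U α β := by
  funext j
  by_cases hj : j ∈ U
  · rw [mix_mem hj, mix_mem hj]
  · rw [mix_notMem hj, mix_notMem hj, flipAt_of_ne _ fun h : j = i => hj (h ▸ hi)]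

lemma Fac.ess_eq [Fintype V] {f h : BoolFun V} {A : Finset V} (hF : Fac f A h)
    (hA : A ⊆ ess f) : ess h = A := by
  refine Finset.Subset.antisymm hF.1.ess_subset fun i hi => ?_
  obtain ⟨α, hα⟩ := mem_ess.1 (hA hi)
  exact mem_ess.2 ⟨α, hF.sens_inner hi hα⟩

lemma Fac.xor_right {f h : BoolFun V} {A : Finset V} (hF : Fac f A h) (s : Bool) :
    Fac f A fun α => Bool.xor (h α) s :=
  ⟨fun α β hαβ => by simp only [hF.1 α β hαβ],
    fun α β hαβ hh => hF.2 α β hαβ (by simpa using hh)⟩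

lemma sens_mix {f : BoolFun V} {B : Finset V} {α₀ α : V → Bool} {i : V} :
    Sens (fun α => f (mix B α₀ α)) α i ↔ i ∉ B ∧ Sens f (mix B α₀ α) i := by
  by_cases hi : i ∈ B
  · simp only [Sens, mix_flipAt_mem hi, hi]; simp
  · simp only [Sens, mix_flipAt_notMem hi, hi]; simp

lemma Fac.sens_off {f h : BoolFun V} {A : Finset V} (hF : Fac f A h) {i : V} (hi : i ∉ A)
    {β γ : V → Bool} (hβγ : EqOff A β γ) (hh : h β = h γ) (hs : Sens f γ i) : Sens f β i := by
  have hfl : ∀ δ, h (flipAt δ i) = h δ := fun δ => hF.1 _ _ fun j hj =>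
    flipAt_of_ne _ fun h => hi (h ▸ hj)
  unfold Sens
  rw [hF.2 β γ hβγ hh, hF.2 (flipAt β i) (flipAt γ i) ?_ (by rw [hfl, hfl, hh])]
  · exact hs
  · intro j hj
    by_cases hji : j = i
    · subst hji; rw [flipAt_self, flipAt_self, hβγ j hj]
    · rw [flipAt_of_ne _ hji, flipAt_of_ne _ hji, hβγ j hj]

/-- Contracting a module `A` to one of its variables `a`. -/
lemma Fac.contract [Fintype V] {f h : BoolFun V} {A : Finset V} (hF : Fac f A h)
    (hA : A ⊆ ess f) {a : V} (ha : a ∈ A) : ∃ (α₀ : V → Bool) (s : Bool),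
      let φ : BoolFun V := fun α => f (mix (A.erase a) α₀ α)
      let h' : BoolFun V := fun α => Bool.xor (h α) s
      (∀ α, h' (mix (A.erase a) α₀ α) = α a) ∧
      (∀ α, f α = φ (Function.update α a (h' α))) ∧ ess φ = insert a (ess f \ A) := by
  -- With `A` apart from `a` frozen at a point sensitive to `a`, `h` becomes a literal of `a`. The
  -- constant `s` removes the negation, so that writing the value of `h'` into `a` reproduces `f`.
  obtain ⟨α₀, hα₀⟩ := mem_ess.1 (hA ha)
  have hs := hF.sens_inner ha hα₀
  have hval : ∀ α, Bool.xor (h (mix (A.erase a) α₀ α)) (Bool.xor (h α₀) (α₀ a)) = α a := by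
    intro α
    by_cases hα : α a = α₀ a
    · have : h (mix (A.erase a) α₀ α) = h α₀ := hF.1 _ _ fun i hi => by
        by_cases hia : i = a
        · subst hia; rw [mix_notMem (by simp), hα]
        · rw [mix_mem (by simp [hia, hi])]
      rw [this, hα]; cases h α₀ <;> cases α₀ a <;> rfl
    · have : h (mix (A.erase a) α₀ α) = h (flipAt α₀ a) := hF.1 _ _ fun i hi => by
        by_cases hia : i = a
        · subst hia; rw [mix_notMem (by simp), flipAt_self]
          revert hα; cases α i <;> cases α₀ i <;> simp
        · rw [mix_mem (by simp [hia, hi]), flipAt_of_ne _ hia]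
      rw [this]
      unfold Sens at hs
      revert hs hα
      cases h (flipAt α₀ a) <;> cases h α₀ <;> cases α₀ a <;> cases α a <;> simp
  refine ⟨α₀, Bool.xor (h α₀) (α₀ a), hval, ?_, ?_⟩
  · intro α
    refine (hF.2 _ _ (fun j hj => ?_) ?_).symm
    · have hja : j ≠ a := fun h => hj (h ▸ ha)
      rw [mix_notMem (by simp [hj]), Function.update_of_ne hja]
    · have := hval (Function.update α a (Bool.xor (h α) (Bool.xor (h α₀) (α₀ a))))
      rw [Function.update_self] at this
      simpa using this
  · ext i
    simp only [mem_ess, Finset.mem_insert, Finset.mem_sdiff, sens_mix]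
    constructor
    · rintro ⟨α, hiA, hα⟩
      by_cases hia : i = a
      · exact Or.inl hia
      · exact Or.inr ⟨⟨_, hα⟩, fun h => hiA (Finset.mem_erase.2 ⟨hia, h⟩)⟩
    · rintro (rfl | ⟨⟨α, hα⟩, hiA⟩)
      · refine ⟨α₀, by simp, ?_⟩
        have hmix : mix (A.erase i) α₀ α₀ = α₀ := by
          funext j
          by_cases hj : j ∈ A.erase i
          · rw [mix_mem hj]
          · rw [mix_notMem hj]
        rwa [hmix]
      · refine ⟨Function.update α a (Bool.xor (h α) (Bool.xor (h α₀) (α₀ a))), by simp [hiA],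
          hF.sens_off hiA (fun j hj => ?_) ?_ hα⟩
        · have hja : j ≠ a := fun h => hj (h ▸ ha)
          rw [mix_notMem (by simp [hj]), Function.update_of_ne hja]
        · have := hval (Function.update α a (Bool.xor (h α) (Bool.xor (h α₀) (α₀ a))))
          rw [Function.update_self] at this
          simpa using this

/-- A composition of normalized read-once functions of disjoint sets of variables with a function
of at most `l` variables is a normalized read-once function. -/
lemma Node.ro [Fintype V] {l : ℕ} {K : Finset V} {q : BoolFun V} {e : V → BoolFun V}
    {U : V → Finset V} (N : Node K q e U) (hK : K.Nonempty) (hl : K.card ≤ l)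
    (he : ∀ x ∈ K, RO l (e x) (U x)) : RO l (comp q e) (K.biUnion U) := by
  obtain ⟨n, hn⟩ : ∃ n, K.card = n := ⟨_, rfl⟩
  induction n using Nat.strong_induction_on generalizing K q e U with
  | _ n ih =>
  have hessq : ess q = K :=
    Finset.Subset.antisymm N.dep.ess_subset fun i hi => mem_ess.2 (N.rel i hi)
  rcases Nat.lt_or_ge K.card 2 with h2 | h2
  -- A node with one branch is the branch itself or its negation.
  · have h1 : K.card = 1 := by have := Finset.card_pos.2 hK; omega
    obtain ⟨x, rfl⟩ := Finset.card_eq_one.1 h1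
    obtain ⟨z, hz⟩ := N.rel x (by simp)
    obtain ⟨s, hs⟩ := literal_on_subcube (T := {x}) (p := z) N.dep
      (fun i hi _ => by simpa using hi) ⟨z, EqOff.refl _ _, hz⟩
    have : comp q e = fun α => Bool.xor (e x α) s := by
      funext α
      have h := hs (fun y => if y = x then e x α else z y) fun y hy => by
        have : y ≠ x := by simpa using hy
        simp [this]
      simp only [if_true] at h
      rw [← h]
      exact N.dep _ _ fun y hy => by
        have : y = x := by simpa using hy
        simp [this]
    rw [this, Finset.singleton_biUnion]
    exact (he x (by simp)).xor_right s
  by_cases hp : K.card = 2 ∨ Prim q K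
  · exact RO.node K q e U N h2 hl hp he
  simp only [Prim, not_or, not_forall] at hp
  -- A proper nontrivial module `A` of `q` splits the node in two: an inner node on `A` and an outer
  -- node on `K` with `A` contracted to `a`. Both have fewer branches than `K`.
  obtain ⟨-, A, hAK, h, hF, hA1, hA2⟩ := hp
  have hlt : A.card < K.card := Finset.card_lt_card ⟨hAK, fun h => hA2 (hAK.antisymm h)⟩
  obtain ⟨a, ha⟩ : A.Nonempty := Finset.card_pos.1 (by omega)
  obtain ⟨α₀, s, hval, hφ, hess⟩ := hF.contract (hessq ▸ hAK) ha
  have hF' := hF.xor_right s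
  set h' : BoolFun V := fun α => Bool.xor (h α) s with hh'
  set φ : BoolFun V := fun α => q (mix (A.erase a) α₀ α) with hφdef
  clear_value h' φ
  rw [hessq] at hess
  have NA : Node A h' e U := ⟨hF'.1, fun x hx => mem_ess.1
    (by rwa [hF'.ess_eq (hessq ▸ hAK)]), fun x hx => N.edep x (hAK hx),
    fun x hx => N.erel x (hAK hx), fun x hx => N.ne x (hAK hx),
    fun x hx y hy => N.disj x (hAK hx) y (hAK hy)⟩
  have roA : RO l (comp h' e) (A.biUnion U) :=
    ih A.card (hn ▸ hlt) NA ⟨a, ha⟩ (by omega) (fun x hx => he x (hAK hx)) rfl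
  let e2 := Function.update e a (comp h' e)
  let U2 := Function.update U a (A.biUnion U)
  have he2 : ∀ x ∈ insert a (K \ A), RO l (e2 x) (U2 x) := by
    intro x hx
    by_cases hxa : x = a
    · subst hxa; simpa [e2, U2] using roA
    · simp only [e2, U2, Function.update_of_ne hxa]
      refine he x ?_
      simp only [Finset.mem_insert, hxa, false_or, Finset.mem_sdiff] at hx
      exact hx.1
  have hdisj : ∀ x ∈ K \ A, Disjoint (U x) (A.biUnion U) := by
    intro x hx
    rw [Finset.mem_sdiff] at hx
    rw [Finset.disjoint_biUnion_right]
    exact fun y hy => N.disj x hx.1 y (hAK hy) fun h => hx.2 (h ▸ hy)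
  have N2 : Node (insert a (K \ A)) φ e2 U2 := by
    refine ⟨hess ▸ depOn_ess φ, fun x hx => mem_ess.1 (hess ▸ hx),
      fun x hx => (he2 x hx).depOn, fun x hx => (he2 x hx).rel,
      fun x hx => (he2 x hx).nonempty, fun x hx y hy hxy => ?_⟩
    simp only [Finset.mem_insert] at hx hy
    by_cases hxa : x = a
    · subst hxa
      have hyx : y ≠ x := Ne.symm hxy
      simp only [U2, Function.update_self, Function.update_of_ne hyx]
      exact (hdisj y (by simpa [hyx] using hy)).symm
    · by_cases hya : y = a
      · subst hya
        simp only [U2, Function.update_self, Function.update_of_ne hxa]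
        exact hdisj x (by simpa [hxa] using hx)
      · simp only [U2, Function.update_of_ne hxa, Function.update_of_ne hya]
        simp only [hxa, hya, false_or, Finset.mem_sdiff] at hx hy
        exact N.disj x hx.1 y hy.1 hxy
  have hcard : (insert a (K \ A)).card < K.card := by
    rw [Finset.card_insert_of_notMem (by simp [ha]), Finset.card_sdiff_of_subset hAK]
    omega
  have ro2 := ih _ (hn ▸ hcard) N2 (by simp) (by omega) he2 rfl
  have hcomp : comp φ e2 = comp q e := by
    funext α
    simp only [comp]
    rw [hφ]
    congr 1
    funext x
    by_cases hxa : x = a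
    · subst hxa; simp [e2, comp]
    · simp [e2, Function.update_of_ne hxa]
  have hU : (insert a (K \ A)).biUnion U2 = K.biUnion U := by
    ext i
    simp only [Finset.mem_biUnion, Finset.mem_insert, Finset.mem_sdiff]
    constructor
    · rintro ⟨x, hx, hi⟩
      by_cases hxa : x = a
      · subst hxa
        simp only [U2, Function.update_self, Finset.mem_biUnion] at hi
        obtain ⟨y, hy, hi⟩ := hi
        exact ⟨y, hAK hy, hi⟩
      · simp only [hxa, false_or] at hx
        simp only [U2, Function.update_of_ne hxa] at hi
        exact ⟨x, hx.1, hi⟩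
    · rintro ⟨x, hx, hi⟩
      by_cases hxA : x ∈ A
      · refine ⟨a, Or.inl rfl, ?_⟩
        simp only [U2, Function.update_self, Finset.mem_biUnion]
        exact ⟨x, hxA, hi⟩
      · have hxa : x ≠ a := fun h => hxA (h ▸ ha)
        exact ⟨x, Or.inr ⟨hx, hxA⟩, by simpa [U2, Function.update_of_ne hxa] using hi⟩
  rwa [hcomp, hU] at ro2

namespace Formula

/-- Labels of a node are elements of `V`, so an argument with relevant variables can be labelled by
one of them; read-onceness makes these labels distinct. Constant arguments are absorbed into `q`,
labels irrelevant to `q` are dropped, and `Node.ro` normalizes the rest. -/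
lemma exists_ro [Fintype V] {l : ℕ} (F : Formula (basisB l) V) (hF : ∀ x, F.occ x ≤ 1) :
    (∃ c, F.eval = fun _ => c) ∨ ∃ U, (∀ x ∈ U, 0 < F.occ x) ∧ RO l F.eval U := by
  classical
  induction F with
  | var x =>
    refine Or.inr ⟨{x}, by simp [occ], ?_⟩
    have : (var x : Formula (basisB l) V).eval = fun α => Bool.xor (α x) false := by
      funext α; simp [eval]
    rw [this]; exact RO.leaf x false
  | app h hB args ih =>
    have hle : ∀ i x, (args i).occ x ≤ (app h hB args).occ x := fun i x =>
      Finset.single_le_sum (f := fun i => (args i).occ x) (fun _ _ => Nat.zero_le _)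
        (Finset.mem_univ i)
    have h1 : ∀ i, ∃ (U : Finset V) (c : Bool), (∀ x ∈ U, 0 < (args i).occ x) ∧
        (U.Nonempty → RO l (args i).eval U) ∧ (¬ U.Nonempty → (args i).eval = fun _ => c) := by
      intro i
      rcases ih i (fun x => (hle i x).trans (hF x)) with ⟨c, hc⟩ | ⟨U, hU, hro⟩
      · exact ⟨∅, c, by simp, by simp, fun _ => hc⟩
      · exact ⟨U, false, hU, fun _ => hro, fun h => absurd hro.nonempty h⟩
    choose U c hU hro hc using h1
    have hinj : ∀ i j x, x ∈ U i → x ∈ U j → i = j := by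
      intro i j x hi hj
      by_contra hij
      have h2 := hF x
      have h3 : (args i).occ x + (args j).occ x ≤ (app h hB args).occ x := by
        rw [occ, ← Finset.sum_pair (f := fun i => (args i).occ x) hij]
        exact Finset.sum_le_sum_of_subset (Finset.subset_univ _)
      have := hU i x hi
      have := hU j x hj
      omega
    rcases isEmpty_or_nonempty V with hV | hV
    · exact Or.inl ⟨_, funext fun α => congrArg _ (Subsingleton.elim α (fun _ => false))⟩
    have h2 : ∀ i, ∃ v : V, (U i).Nonempty → v ∈ U i := fun i => by
      by_cases hi : (U i).Nonempty
      · exact ⟨hi.choose, fun _ => hi.choose_spec⟩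
      · exact ⟨Classical.arbitrary V, fun h => absurd h hi⟩
    choose lab hlab using h2
    have h3 : ∃ idx : V → Option (Fin h.1), ∀ i, (U i).Nonempty → idx (lab i) = some i := by
      refine ⟨fun v => if hv : ∃ i, (U i).Nonempty ∧ lab i = v then some hv.choose else none,
        fun i hi => ?_⟩
      have hv : ∃ j, (U j).Nonempty ∧ lab j = lab i := ⟨i, hi, rfl⟩
      simp only [hv, dif_pos, Option.some.injEq]
      refine hinj _ _ (lab i) ?_ (hlab i hi)
      have h := hlab _ hv.choose_spec.1
      rwa [hv.choose_spec.2] at h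
    obtain ⟨idx, hidx⟩ := h3
    let q : BoolFun V := fun z => h.2 fun i => if (U i).Nonempty then z (lab i) else c i
    let e : V → BoolFun V := fun v => (idx v).elim (fun _ => false) fun i => (args i).eval
    let U' : V → Finset V := fun v => (idx v).elim ∅ U
    have he : ∀ i, (U i).Nonempty → e (lab i) = (args i).eval := fun i hi => by
      simp only [e, hidx i hi, Option.elim]
    have hU' : ∀ i, (U i).Nonempty → U' (lab i) = U i := fun i hi => by
      simp only [U', hidx i hi, Option.elim]
    have hqdep : DepOn q (Finset.univ.filter fun v => ∃ i, (U i).Nonempty ∧ v = lab i) := by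
      intro z z' hz
      refine congrArg h.2 (funext fun i => ?_)
      by_cases hi : (U i).Nonempty
      · simp only [hi, if_true]
        exact hz _ (by simp only [Finset.mem_filter, Finset.mem_univ, true_and]
                       exact ⟨i, hi, rfl⟩)
      · simp only [hi, if_false]
    have hKL : ∀ x ∈ ess q, ∃ i, (U i).Nonempty ∧ x = lab i := fun x hx => by
      simpa using hqdep.ess_subset hx
    have hcomp : (app h hB args).eval = comp q e := by
      funext α
      refine congrArg h.2 (funext fun i => ?_)
      by_cases hi : (U i).Nonempty
      · simp only [hi, if_true, he i hi]
      · simp only [hi, if_false, hc i hi]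
    have hroK : ∀ x ∈ ess q, RO l (e x) (U' x) := by
      intro x hx
      obtain ⟨i, hi, rfl⟩ := hKL x hx
      rw [he i hi, hU' i hi]
      exact hro i hi
    have N : Node (ess q) q e U' := by
      refine ⟨depOn_ess q, fun x hx => mem_ess.1 hx, fun x hx => (hroK x hx).depOn,
        fun x hx => (hroK x hx).rel, fun x hx => (hroK x hx).nonempty, fun x hx y hy hxy => ?_⟩
      obtain ⟨i, hi, rfl⟩ := hKL x hx
      obtain ⟨j, hj, rfl⟩ := hKL y hy
      rw [hU' i hi, hU' j hj, Finset.disjoint_left]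
      exact fun k hki hkj => hxy (by rw [hinj i j k hki hkj])
    by_cases hne : (ess q).Nonempty
    · refine Or.inr ⟨(ess q).biUnion U', fun k hk => ?_, hcomp ▸ N.ro hne ?_ hroK⟩
      · obtain ⟨x, hx, hk⟩ := Finset.mem_biUnion.1 hk
        obtain ⟨i, hi, rfl⟩ := hKL x hx
        rw [hU' i hi] at hk
        exact (hU _ k hk).trans_le (hle _ k)
      · have hk : h.1 ≤ l := hB
        refine le_trans ?_ hk
        calc (ess q).card ≤ (Finset.univ.image lab).card := Finset.card_le_card fun x hx => by
              obtain ⟨i, -, rfl⟩ := hKL x hx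
              exact Finset.mem_image_of_mem _ (Finset.mem_univ _)
          _ ≤ (Finset.univ : Finset (Fin h.1)).card := Finset.card_image_le
          _ = h.1 := Finset.card_fin _
    · refine Or.inl ⟨q fun _ => false, ?_⟩
      rw [Finset.not_nonempty_iff_eq_empty] at hne
      rw [hcomp]
      funext α
      exact depOn_ess q (fun x => e x α) (fun _ => false) fun i hi => by simp [hne] at hi

/-- Substituting constants for the variables of `s`. -/
def fix {l : ℕ} (s : Finset V) (p : V → Bool) : Formula (basisB l) V → Formula (basisB l) V
  | var x => if x ∈ s then app ⟨0, fun _ => p x⟩ (Nat.zero_le l) Fin.elim0 else var x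
  | app h hB args => app h hB fun i => (args i).fix s p

lemma eval_fix {l : ℕ} (s : Finset V) (p α : V → Bool) (F : Formula (basisB l) V) :
    (F.fix s p).eval α = F.eval (mix s p α) := by
  induction F with
  | var x =>
    by_cases hx : x ∈ s
    · simp [fix, hx, eval, mix]
    · simp [fix, hx, eval, mix]
  | app h hB args ih => simp only [fix, eval, ih]

lemma occ_fix_le {l : ℕ} (s : Finset V) (p : V → Bool) (F : Formula (basisB l) V) (x : V) :
    (F.fix s p).occ x ≤ F.occ x := by
  induction F with
  | var y =>
    by_cases hy : y ∈ s
    · simp [fix, hy, occ]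
    · simp [fix, hy]
  | app h hB args ih => exact Finset.sum_le_sum fun i _ => ih i

end Formula

/-- Contracting a module substitutes constants for all but one of its variables, so the induction
stays among read-once functions. -/
lemma IsReadOnce.mix {l : ℕ} {f : BoolFun V} (h : IsReadOnce (basisB l) f) (s : Finset V)
    (p : V → Bool) : IsReadOnce (basisB l) fun α => f (mix s p α) := by
  obtain ⟨F, hF, rfl⟩ := h
  exact ⟨F.fix s p, fun x => (F.occ_fix_le s p x).trans (hF x),
    funext fun α => F.eval_fix s p α⟩

lemma IsReadOnce.ro [Fintype V] {l : ℕ} {f : BoolFun V} (h : IsReadOnce (basisB l) f)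
    (hne : (ess f).Nonempty) : RO l f (ess f) := by
  obtain ⟨F, hF, rfl⟩ := h
  rcases F.exists_ro hF with ⟨c, hc⟩ | ⟨U, -, hU⟩
  · obtain ⟨x, hx⟩ := hne
    obtain ⟨α, hα⟩ := mem_ess.1 hx
    exact absurd (by rw [hc]) hα
  · rwa [hU.ess_eq]

end ReadOnce

end CheckingTest
namespace CheckingTest

/-! ### How a module `{a, b}` of `g` constrains the dependence of `f` on `a`. -/

section Twins

set_option linter.unusedSectionVars false

variable {V : Type*} [DecidableEq V]

lemma Fac.exists_xor {f e : BoolFun V} {U : Finset V} (hF : Fac f U e) {α : V → Bool} {i : V}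
    (hi : i ∈ U) (hs : Sens f α i) : ∃ t, ∀ β, EqOff U β α → f β = xor (e β) t := by
  refine ⟨xor (f α) (e α), fun β hβ => ?_⟩
  have h := hF.eq_iff hi hs hβ (EqOff.refl _ _)
  revert h
  cases f β <;> cases f α <;> cases e β <;> cases e α <;> simp

/-- Behaviour of `f` on the subcube with free components `W` through `p` as a function of `a`: for
`some v`, the restriction is constant where `a` has the value `v` (as in a conjunction); for
`none`, it always changes with `a` (as in a sum modulo 2). -/
def Lin (o : Option Bool) (f : BoolFun V) (a : V) (W : Finset V) (p : V → Bool) : Prop :=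
  match o with
  | some v => ∀ α β, EqOff W α p → EqOff W β p → α a = v → β a = v → f α = f β
  | none => ∀ α, EqOff W α p → Sens f α a

/-- How `g` depends on `b` relative to `a` when `{a, b}` is a module. -/
def PairType (o : Option Bool) (g : BoolFun V) (a b : V) : Prop :=
  match o with
  | some v => ∀ α, α a = v → ¬ Sens g α b
  | none => ∀ α, g (flipAt (flipAt α a) b) = g α

/-- On the common cube `f = g` is a function `F` of the bits `E` and `b`. For `some v`: where `a =
v`, `g` ignores `b`, so `E` avoids the value at which `F` reacts to `b` and is therefore constant.
For `none`: flipping `a` and `b` together preserves `g`, which makes `F` a sum of its two bits up to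
a constant, so `E` must change with every flip of `a`. -/
lemma lin_of_agreeOn {f g E : BoolFun V} {U W : Finset V} {a b : V} {o : Option Bool}
    (hF : Fac f U E) (hb : b ∉ U) (ha : a ∈ U) (haW : a ∈ W) (hbW : b ∈ W)
    (hW : W ⊆ insert b U) (hR : AgreeOn f g W) (hG : PairType o g a b) :
    ∃ p, Lin o E a W p ∧ ∀ i ∈ W, i ∈ U → ∃ α, EqOff W α p ∧ Sens E α i := by
  classical
  obtain ⟨p, hsep, hfg⟩ := hR
  refine ⟨p, ?_, fun i hi hiU => ?_⟩
  swap
  · obtain ⟨α, hα, hs⟩ := hsep i hi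
    exact ⟨α, hα, hF.sens_inner hiU hs⟩
  obtain ⟨α₂, hα₂, hs₂⟩ := hsep b hbW
  obtain ⟨α₁, hα₁, hs₁⟩ := hsep a haW
  replace hs₁ := hF.sens_inner ha hs₁
  have hab : a ≠ b := fun h => hb (h ▸ ha)
  have hEb : ∀ α, E (flipAt α b) = E α := fun α => hF.1 _ _ fun j hj =>
    flipAt_of_ne _ fun h => hb (h ▸ hj)
  obtain ⟨F, hFF⟩ : ∃ F : Bool → Bool → Bool, ∀ α, EqOff W α p → f α = F (E α) (α b) := by
    refine ⟨fun x y => if h : ∃ α, EqOff W α p ∧ E α = x ∧ α b = y then f h.choose else false,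
      fun α hα => ?_⟩
    have h : ∃ β, EqOff W β p ∧ E β = E α ∧ β b = α b := ⟨α, hα, rfl, rfl⟩
    simp only [h, dif_pos]
    refine hF.2 _ _ (fun j hj => ?_) h.choose_spec.2.1.symm
    by_cases hjb : j = b
    · rw [hjb, h.choose_spec.2.2]
    · have : j ∉ W := fun hjW => (Finset.mem_insert.1 (hW hjW)).elim hjb hj
      rw [hα j this, h.choose_spec.1 j this]
  have hfl : ∀ α, EqOff W α p → f (flipAt α b) = F (E α) (!α b) := fun α hα => by
    rw [hFF _ (hα.flip hbW), hEb, flipAt_self]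
  unfold Sens at hs₂
  rw [hfl α₂ hα₂, hFF α₂ hα₂] at hs₂
  cases o with
  | some v =>
    have key : ∀ α, EqOff W α p → α a = v → E α ≠ E α₂ := by
      intro α hα hav hE
      have h := hG α hav
      unfold Sens at h
      push Not at h
      rw [← hfg _ hα, ← hfg _ (hα.flip hbW), hfl α hα, hFF α hα, hE] at h
      revert h hs₂
      cases α b <;> cases α₂ b <;> simp <;> grind
    intro α β hα hβ hαv hβv
    have h1 := key α hα hαv
    have h2 := key β hβ hβv
    revert h1 h2
    cases E α <;> cases E β <;> cases E α₂ <;> simp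
  | none =>
    have key : ∀ α, EqOff W α p → F (E (flipAt α a)) (!α b) = F (E α) (α b) := fun α hα => by
      rw [← hFF α hα, hfg _ hα, ← hG α, ← hfg _ ((hα.flip haW).flip hbW),
        hfl _ (hα.flip haW), flipAt_of_ne _ hab.symm]
    intro α hα hs
    have k1 := key α hα
    have k2 := key α₁ hα₁
    have k3 := key _ (hα₁.flip hbW)
    rw [flipAt_comm, hEb, hEb, flipAt_self] at k3
    rw [hs] at k1
    have hE1 : E (flipAt α₁ a) = !E α₁ := by
      unfold Sens at hs₁
      revert hs₁; cases E (flipAt α₁ a) <;> cases E α₁ <;> simp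
    rw [hE1] at k2 k3
    -- The two values of `b`, at a point where `E` reacts to `a`, cover all four arguments of `F`.
    have hall : ∀ x y, F (!x) (!y) = F x y := by
      clear k1 hs₂
      revert k2 k3
      generalize E α₁ = u
      generalize α₁ b = v
      intro k2 k3 x y
      cases u <;> cases v <;> cases x <;> cases y <;> simp_all
    have h1 := hall false false
    have h2 := hall false true
    clear k2 k3 hall
    revert k1 hs₂ h1 h2
    generalize E α = u, α b = v, E α₂ = u', α₂ b = v'
    cases u <;> cases v <;> cases u' <;> cases v' <;> simp <;> grind

/-- A node on a subcube whose only free variable outside the branches is `b`: relation to the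
function `q` at the node. -/
lemma Node.lin_q {K : Finset V} {q : BoolFun V} {e : V → BoolFun V} {U : V → Finset V}
    (N : Node K q e U) {τ : V → V} (hτ : ∀ x ∈ K, τ x ∈ U x) {J : Finset V} (hJ : J ⊆ K)
    {x₁ b : V} (hx₁ : x₁ ∈ J) (hb : b ∉ K.biUnion U) {o : Option Bool} {p p₀ : V → Bool}
    [Fintype V] (hlin : Lin o (comp q e) (τ x₁) (insert b (J.image τ)) p)
    (hs : ∀ x ∈ J, ∃ α, EqOff (insert b (J.image τ)) α p ∧ Sens (comp q e) α (τ x))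
    (hlin₁ : Lin o (e x₁) (τ x₁) Finset.univ p₀) :
    ∃ c, Lin (o.map fun v => e x₁ fun _ => v) q x₁ J c ∧ Sep q J c := by
  have hJT : ∀ x ∈ J, τ x ∈ insert b (J.image τ) := fun x hx =>
    Finset.mem_insert_of_mem (Finset.mem_image_of_mem _ hx)
  obtain ⟨s, hs1, hs2, hs3, hs4⟩ := N.realize hτ hJ (T := insert b (J.image τ)) (p := p)
    (fun x hx i hi hix => by
      rcases Finset.mem_insert.1 hi with rfl | hi
      · exact absurd (N.subset hx hix) hb
      · obtain ⟨y, hy, rfl⟩ := Finset.mem_image.1 hi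
        have := N.eq_of_mem (hJ hy) hx (hτ y (hJ hy)) hix
        subst this
        exact ⟨hy, rfl⟩) hJT hs
  refine ⟨_, ?_, hs3⟩
  have hz : ∀ z, EqOff J z (fun x => e x p) → ∃ α, EqOff (insert b (J.image τ)) α p ∧
      ∀ x ∈ K, e x α = z x := by
    intro z hz
    obtain ⟨α, hα, -, h⟩ := hs4 z p (EqOff.refl _ _)
    refine ⟨α, hα, fun x hx => ?_⟩
    by_cases hxJ : x ∈ J
    · exact h x hxJ
    · rw [hz x hxJ]; exact hs2 α hα x hx hxJ
  cases o with
  | some v =>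
    have hv : ∀ α, EqOff (insert b (J.image τ)) α p → e x₁ α = e x₁ (fun _ => v) →
        α (τ x₁) = v := by
      intro α hα he
      by_contra hne
      have h1 : e x₁ (flipAt α (τ x₁)) = e x₁ fun _ => v :=
        hlin₁ _ _ (fun j hj => by simp at hj) (fun j hj => by simp at hj)
          (by rw [flipAt_self]; revert hne; cases α (τ x₁) <;> cases v <;> simp) rfl
      rw [← he, hs1 α hα x₁ hx₁, hs1 _ (hα.flip (hJT x₁ hx₁)) x₁ hx₁, flipAt_self] at h1
      revert h1; cases α (τ x₁) <;> cases s x₁ <;> simp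
    intro z z' hz1 hz2 hzv hzv'
    obtain ⟨α, hα, h1⟩ := hz z hz1
    obtain ⟨β, hβ, h2⟩ := hz z' hz2
    have := hlin α β hα hβ (hv α hα (by rw [h1 _ (hJ hx₁), hzv]))
      (hv β hβ (by rw [h2 _ (hJ hx₁), hzv']))
    rw [N.dep z (fun x => e x α) fun x hx => (h1 x hx).symm,
      N.dep z' (fun x => e x β) fun x hx => (h2 x hx).symm]
    exact this
  | none =>
    intro z hz1
    obtain ⟨α, hα, h1⟩ := hz z hz1
    have := ((N.sens_iff (hJ hx₁) (hτ x₁ (hJ hx₁))).1 (hlin α hα)).1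
    exact N.dep.sens this fun x hx => (h1 x hx).symm

/-- Here `e x₁ fun _ => v` is the constant value which the branch takes wherever `a = v`; any vector
with `a = v` would serve to name it. -/
lemma Node.lin_comp {K : Finset V} {q : BoolFun V} {e : V → BoolFun V} {U : V → Finset V}
    (N : Node K q e U) [Fintype V] {x₁ a : V} (hx₁ : x₁ ∈ K) (ha : a ∈ U x₁)
    {o : Option Bool} {p p₁ p₂ : V → Bool} (hlin₁ : Lin o (e x₁) a Finset.univ p₁)
    (hq : Lin (o.map fun v => e x₁ fun _ => v) q x₁ Finset.univ p₂) :
    Lin o (comp q e) a Finset.univ p := by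
  have hu : ∀ α p : V → Bool, EqOff Finset.univ α p := fun α p j hj => by simp at hj
  cases o with
  | some v =>
    intro α β _ _ hα hβ
    exact hq _ _ (hu _ _) (hu _ _) (hlin₁ _ _ (hu _ _) (hu _ _) hα rfl)
      (hlin₁ _ _ (hu _ _) (hu _ _) hβ rfl)
  | none =>
    intro α _
    exact (N.sens_iff hx₁ ha).2 ⟨hq _ (hu _ _), hlin₁ _ (hu _ _)⟩

lemma Lin.univ_of_depOn [Fintype V] {q : BoolFun V} {K : Finset V} (hq : DepOn q K) {x : V}
    (hx : x ∈ K) {o : Option Bool} {c p : V → Bool} (h : Lin o q x K c) :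
    Lin o q x Finset.univ p := by
  have hm : ∀ z, q (mix K z c) = q z := fun z => hq _ _ fun i hi => mix_mem hi _ _
  cases o with
  | some v =>
    intro α β _ _ hα hβ
    rw [← hm α, ← hm β]
    exact h _ _ (eqOff_mix _ _ _) (eqOff_mix _ _ _) (by rw [mix_mem hx, hα])
      (by rw [mix_mem hx, hβ])
  | none =>
    intro α _
    exact hq.sens (h _ (eqOff_mix K α c)) fun j hj => (mix_mem hj _ _).symm

/-- A single value of `x₁` preserves sensitivity to all other variables: the value opposite to the
absorbing one for `some`, and either value for `none`, since flipping `x₁` always negates `q`. The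
first cube handles every variable except `i`, and the second handles `i`. -/
lemma sepEx_erase_of_lin {q : BoolFun V} {K : Finset V} (hq : DepOn q K) {x₁ i j : V}
    (hx₁ : x₁ ∈ K) (hij : i ≠ j) {o : Option Bool} {c d : V → Bool}
    (hi : Lin o q x₁ (K.erase i) c) (hi' : Sep q (K.erase i) c)
    (hj : Lin o q x₁ (K.erase j) d) (hj' : Sep q (K.erase j) d) (hxi : x₁ ≠ i) (hxj : x₁ ≠ j) :
    SepEx q (K.erase x₁) := by
  obtain ⟨v, hv⟩ : ∃ v : Bool, ∀ m c, x₁ ≠ m → Lin o q x₁ (K.erase m) c →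
      Sep q (K.erase m) c → ∀ k ∈ K, k ≠ x₁ → k ≠ m → ∃ z, z x₁ = v ∧ Sens q z k := by
    refine ⟨o.elim false (!·), fun m c hxm hm hm' k hk hkx hkm => ?_⟩
    obtain ⟨z, hz, hs⟩ := hm' k (Finset.mem_erase.2 ⟨hkm, hk⟩)
    cases o with
    | some κ =>
      refine ⟨z, ?_, hs⟩
      by_contra hne
      have hzx : z x₁ = κ := by
        revert hne; simp only [Option.elim]; cases z x₁ <;> cases κ <;> simp
      exact hs (hm _ _ (hz.flip (Finset.mem_erase.2 ⟨hkm, hk⟩)) hz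
        (by rw [flipAt_of_ne _ hkx.symm, hzx]) hzx)
    | none =>
      by_cases hzx : z x₁ = false
      · exact ⟨z, hzx, hs⟩
      · refine ⟨flipAt z x₁, by simp only [flipAt_self, Option.elim]; simpa using hzx, ?_⟩
        have h1 := hm z hz
        have h2 := hm _ (hz.flip (Finset.mem_erase.2 ⟨hkm, hk⟩))
        unfold Sens at hs h1 h2 ⊢
        rw [flipAt_comm]
        revert hs h1 h2
        cases q z <;> cases q (flipAt z k) <;> cases q (flipAt z x₁) <;>
          cases q (flipAt (flipAt z k) x₁) <;> simp
  refine ⟨Function.update c x₁ v, fun k hk => ?_⟩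
  rw [Finset.mem_erase] at hk
  have : ∃ z, z x₁ = v ∧ Sens q z k := by
    by_cases hki : k = i
    · exact hv j d hxj hj hj' k hk.2 hk.1 fun h => hij (hki ▸ h)
    · exact hv i c hxi hi hi' k hk.2 hk.1 hki
  obtain ⟨z, hzx, hs⟩ := this
  refine ⟨mix K z (Function.update c x₁ v), fun j hj => ?_, hq.sens hs fun j hj => mix_mem hj _ _⟩
  by_cases hjK : j ∈ K
  · have : j = x₁ := by
      by_contra h
      exact hj (Finset.mem_erase.2 ⟨h, hjK⟩)
    subst this
    rw [mix_mem hjK, hzx, Function.update_self]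
  · rw [mix_notMem hjK]

end Twins

end CheckingTest
namespace CheckingTest

/-! ### Rigidity of prime projections to `l` variables. -/

section Rigidity

set_option linter.unusedSectionVars false

variable {V : Type*} [DecidableEq V]

lemma eqOff_mix_of_eqOff {U : Finset V} {α β : V → Bool} (W : Finset V) (p : V → Bool)
    (h : EqOff U α β) : EqOff U (mix W α p) (mix W β p) := fun j hj => by
  by_cases hjW : j ∈ W
  · rw [mix_mem hjW, mix_mem hjW]; exact h j hj
  · rw [mix_notMem hjW, mix_notMem hjW]

lemma mix_eq_of_eqOff {W : Finset V} {α p : V → Bool} (h : EqOff W α p) : mix W α p = α := by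
  funext j
  by_cases hj : j ∈ W
  · rw [mix_mem hj]
  · rw [mix_notMem hj, h j hj]

/-- If a read-once function over `B_l` has a prime projection to `l` variables, then all its
projections to these variables that depend on all of them are the same up to negations. -/
lemma RO.rigid {l : ℕ} (hl : 3 ≤ l) {e : BoolFun V} {U T : Finset V} {p p' : V → Bool}
    (h : RO l e U) (hT : T.card = l) (hp : Sep e T p) (hp' : Sep e T p')
    (hprime : ∀ A ⊆ T, ∀ h, Fac (fun α => e (mix T α p)) A h → A.card ≤ 1 ∨ A = T) :
    ∃ (s : V → Bool) (t : Bool), ∀ α α', EqOff T α p → EqOff T α' p' →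
      (∀ i ∈ T, α' i = Bool.xor (α i) (s i)) → e α' = Bool.xor (e α) t := by
  induction h with
  | leaf x s =>
    have hsub : T ⊆ {x} := fun i hi => by
      obtain ⟨α, -, hs⟩ := hp i hi
      exact (RO.leaf (l := l) x s).depOn.mem hs
    have := Finset.card_le_card hsub
    simp at this
    omega
  | node K q e U N h2 hlK hpr he ih =>
    have hTU : T ⊆ K.biUnion U := fun i hi => by
      obtain ⟨α, -, hs⟩ := hp i hi
      exact N.depOn.mem hs
    by_cases hx : ∃ x ∈ K, T ⊆ U x
    · obtain ⟨x, hx, hTx⟩ := hx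
      have hTx' : T ∩ U x = T := Finset.inter_eq_left.2 hTx
      have h1 := (N.fac hx).sep_inner hp
      have h2 := (N.fac hx).sep_inner hp'
      rw [hTx'] at h1 h2
      obtain ⟨s, t, hst⟩ := ih x hx h1 h2 fun A hA h hF => hprime A hA h ⟨hF.1, fun α β h1 h2 =>
        (N.fac hx).2 _ _ (eqOff_mix_of_eqOff _ _ (h1.mono (hA.trans hTx))) (hF.2 α β h1 h2)⟩
      obtain ⟨i, hi⟩ : T.Nonempty := Finset.card_pos.1 (by omega)
      obtain ⟨α, hα, hs⟩ := hp i hi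
      obtain ⟨α', hα', hs'⟩ := hp' i hi
      obtain ⟨u, hu⟩ := (N.fac hx).exists_xor (hTx hi) hs
      obtain ⟨u', hu'⟩ := (N.fac hx).exists_xor (hTx hi) hs'
      refine ⟨s, Bool.xor t (Bool.xor u u'), fun β β' hβ hβ' hβs => ?_⟩
      rw [hu β ((hβ.trans hα.symm).mono hTx), hu' β' ((hβ'.trans hα'.symm).mono hTx),
        hst β β' hβ hβ' hβs]
      cases e x β <;> cases t <;> cases u <;> cases u' <;> rfl
    · push Not at hx
      -- The trace of `T` on a branch is a module of the prime projection. Since `T` has `l`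
      -- elements and there are at most `l` branches, each branch has exactly one variable of `T`,
      -- and on every hypercube it is a literal of that variable.
      have h1 : ∀ x ∈ K, (T ∩ U x).card ≤ 1 := by
        intro x hxK
        refine (hprime (T ∩ U x) Finset.inter_subset_left (fun α => e x (mix T α p))
          ⟨fun α β hαβ => N.edep x hxK _ _ fun i hi => ?_, fun α β hαβ hh =>
            (N.fac hxK).2 _ _ (eqOff_mix_of_eqOff _ _ (hαβ.mono Finset.inter_subset_right))
              hh⟩).resolve_right fun h => hx x hxK (Finset.inter_eq_left.1 h)
        by_cases hiT : i ∈ T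
        · rw [mix_mem hiT, mix_mem hiT]; exact hαβ i (Finset.mem_inter.2 ⟨hiT, hi⟩)
        · rw [mix_notMem hiT, mix_notMem hiT]
      have h3 : T.card ≤ ∑ x ∈ K, (T ∩ U x).card := by
        refine le_trans (Finset.card_le_card fun i hi => ?_) Finset.card_biUnion_le
        obtain ⟨x, hx, hix⟩ := Finset.mem_biUnion.1 (hTU hi)
        exact Finset.mem_biUnion.2 ⟨x, hx, Finset.mem_inter.2 ⟨hi, hix⟩⟩
      have h4 : ∀ x ∈ K, (T ∩ U x).card = 1 := by
        by_contra! hcon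
        obtain ⟨x, hx, hx'⟩ := hcon
        have := Finset.sum_lt_sum (f := fun x => (T ∩ U x).card) (g := fun _ => 1) h1
          ⟨x, hx, lt_of_le_of_ne (h1 x hx) hx'⟩
        simp only [Finset.sum_const, smul_eq_mul, mul_one] at this
        omega
      have h5 : ∀ x, ∃ t, x ∈ K → T ∩ U x = {t} := fun x => by
        by_cases hx : x ∈ K
        · obtain ⟨t, ht⟩ := Finset.card_eq_one.1 (h4 x hx)
          exact ⟨t, fun _ => ht⟩
        · exact ⟨x, fun h => absurd h hx⟩
      choose τ hτ using h5
      have hτm : ∀ x ∈ K, τ x ∈ T ∧ τ x ∈ U x := fun x hx =>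
        Finset.mem_inter.1 (by rw [hτ x hx]; simp)
      have hlit : ∀ r, Sep (comp q e) T r → ∀ x, ∃ s, x ∈ K →
          ∀ β, EqOff T β r → e x β = Bool.xor (β (τ x)) s := fun r hr x => by
        by_cases hx : x ∈ K
        · obtain ⟨s, hs⟩ := literal_on_subcube (T := T) (p := r) (t := τ x) (N.edep x hx)
            (fun i hi hiU => by
              have := Finset.mem_inter.2 ⟨hi, hiU⟩
              rw [hτ x hx] at this
              simpa using this)
            (by
              obtain ⟨α, hα, hs⟩ := hr _ (hτm x hx).1
              exact ⟨α, hα, (N.fac hx).sens_inner (hτm x hx).2 hs⟩)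
          exact ⟨s, fun _ => hs⟩
        · exact ⟨false, fun h => absurd h hx⟩
      choose s1 hs1 using hlit p hp
      choose s2 hs2 using hlit p' hp'
      obtain ⟨own, hown⟩ := N.exists_owner
      refine ⟨fun i => Bool.xor (s1 (own i)) (s2 (own i)), false, fun α α' hα hα' hαα' => ?_⟩
      rw [Bool.xor_false]
      refine N.dep _ _ fun x hx => ?_
      rw [hs1 x hx α hα, hs2 x hx α' hα', hαα' _ (hτm x hx).1]
      simp only [hown x hx _ (hτm x hx).2]
      cases α (τ x) <;> cases s1 x <;> cases s2 x <;> rfl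

namespace Node

variable {K : Finset V} {q : BoolFun V} {e : V → BoolFun V} {U : V → Finset V}

lemma realize_transversal (N : Node K q e U) {τ : V → V} (hτ : ∀ x ∈ K, τ x ∈ U x)
    {p : V → Bool} (hs : Sep (comp q e) (K.image τ) p) :
    ∃ (s : V → Bool) (ρ : (V → Bool) → V → Bool), ∀ z, EqOff (K.image τ) (ρ z) p ∧
      (∀ x ∈ K, ρ z (τ x) = Bool.xor (z x) (s x)) ∧ comp q e (ρ z) = q z ∧
      ∀ x ∈ K, e x (ρ z) = z x := by
  obtain ⟨s, hs1, -, -, hs4⟩ := N.realize hτ (Finset.Subset.refl K) (T := K.image τ) (p := p)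
    (fun x hx i hi hix => by
      obtain ⟨y, hy, rfl⟩ := Finset.mem_image.1 hi
      have := N.eq_of_mem hy hx (hτ y hy) hix
      subst this
      exact ⟨hy, rfl⟩) (fun x hx => Finset.mem_image_of_mem _ hx)
    fun x hx => hs _ (Finset.mem_image_of_mem _ hx)
  choose ρ hρ using fun z => hs4 z p (EqOff.refl _ _)
  refine ⟨s, ρ, fun z => ⟨(hρ z).1, fun x hx => ?_, N.dep _ _ (hρ z).2.2, (hρ z).2.2⟩⟩
  have h1 := hs1 _ (hρ z).1 x hx
  rw [(hρ z).2.2 x hx] at h1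
  rw [h1]; cases ρ z (τ x) <;> cases s x <;> rfl

/-- A module of the function on a transversal subcube induces a module of `q`. -/
lemma fac_of_transversal (N : Node K q e U) {τ : V → V} (hτ : ∀ x ∈ K, τ x ∈ U x)
    {p : V → Bool} (hs : Sep (comp q e) (K.image τ) p) {G h : BoolFun V} {A : Finset V}
    {t : Bool} (hG : ∀ α, EqOff (K.image τ) α p → G α = Bool.xor (comp q e α) t)
    (hF : Fac G A h) : ∃ h', Fac q (K.filter fun x => τ x ∈ A) h' := by
  obtain ⟨s, ρ, hρ⟩ := N.realize_transversal hτ hs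
  refine ⟨fun z => h (ρ z), fun z z' hz => hF.1 _ _ fun i hi => ?_, fun z z' hz hh => ?_⟩
  · by_cases hiT : i ∈ K.image τ
    · obtain ⟨x, hx, rfl⟩ := Finset.mem_image.1 hiT
      rw [(hρ z).2.1 x hx, (hρ z').2.1 x hx, hz x (Finset.mem_filter.2 ⟨hx, hi⟩)]
    · rw [(hρ z).1 i hiT, (hρ z').1 i hiT]
  · have := hF.2 (ρ z) (ρ z') (fun i hi => by
      by_cases hiT : i ∈ K.image τ
      · obtain ⟨x, hx, rfl⟩ := Finset.mem_image.1 hiT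
        rw [(hρ z).2.1 x hx, (hρ z').2.1 x hx,
          hz x fun hx' => hi (Finset.mem_filter.1 hx').2]
      · rw [(hρ z).1 i hiT, (hρ z').1 i hiT]) hh
    rw [hG _ (hρ z).1, hG _ (hρ z').1, (hρ z).2.2.1, (hρ z').2.2.1] at this
    simpa using this

end Node

lemma Sep.congr {f g : BoolFun V} {W : Finset V} {p : V → Bool} (h : Sep f W p)
    (hfg : ∀ α, EqOff W α p → f α = g α) : Sep g W p := fun i hi => by
  obtain ⟨α, hα, hs⟩ := h i hi
  refine ⟨α, hα, ?_⟩
  unfold Sens at *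
  rwa [← hfg _ hα, ← hfg _ (hα.flip hi)]

/-- Transporting a prime node with `l` branches along a module `{a, b}` of `g`. -/
lemma Node.exists_transport [Fintype V] {l : ℕ} (hl : 3 ≤ l) {f g h E : BoolFun V}
    {K UE : Finset V} {q : BoolFun V} {e : V → BoolFun V} {U : V → Finset V}
    (N : Node K q e U) (hKl : K.card = l) (hprim : Prim q K) {τ : V → V}
    (hτ : ∀ x ∈ K, τ x ∈ U x) {x₁ b : V} (hx₁ : x₁ ∈ K) (hE : E = comp q e)
    (hUE : UE = K.biUnion U) (hF : Fac f UE E) (hb : b ∉ UE)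
    (hg : IsReadOnce (basisB l) g) (hgh : Fac g {τ x₁, b} h)
    {pT pW : V → Bool} (hT : Sep f (K.image τ) pT)
    (hT' : ∀ α, EqOff (K.image τ) α pT → f α = g α)
    (hW : Sep f (insert b ((K.erase x₁).image τ)) pW)
    (hW' : ∀ α, EqOff (insert b ((K.erase x₁).image τ)) α pW → f α = g α) :
    ∃ (ρ : (V → Bool) → V → Bool) (s t : Bool), ∀ z,
      EqOff (insert b ((K.erase x₁).image τ)) (ρ z) pW ∧ q z = Bool.xor (f (ρ z)) t ∧
      ρ z b = Bool.xor (z x₁) s ∧ ρ (flipAt z x₁) = flipAt (ρ z) b := by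
  subst hE hUE
  set a := τ x₁ with ha
  set T := K.image τ with hTdef
  set W := insert b ((K.erase x₁).image τ) with hWdef
  have hTU : T ⊆ K.biUnion U := N.image_subset hτ (Finset.Subset.refl _)
  have haT : a ∈ T := Finset.mem_image_of_mem _ hx₁
  have hbT : b ∉ T := fun h => hb (hTU h)
  have hab : a ≠ b := fun h => hbT (h ▸ haT)
  have hbW : b ∈ W := Finset.mem_insert_self _ _
  have haW : a ∉ W := by
    simp only [hWdef, Finset.mem_insert, Finset.mem_image, Finset.mem_erase, not_or, hab,
      not_false_eq_true, true_and, not_exists, not_and]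
    rintro x ⟨hx, hxK⟩ hxa
    exact hx (N.eq_of_mem hxK hx₁ (hτ x hxK) (hxa ▸ hτ x₁ hx₁))
  have hWT : ∀ i, i ∈ W → i ≠ b → i ∈ T := fun i hi hib => by
    rcases Finset.mem_insert.1 hi with rfl | hi
    · exact absurd rfl hib
    · exact Finset.image_subset_image (Finset.erase_subset _ _) hi
  have hTW : ∀ i, i ∈ T → i ≠ a → i ∈ W := fun i hi hia => by
    obtain ⟨x, hx, rfl⟩ := Finset.mem_image.1 hi
    refine Finset.mem_insert_of_mem (Finset.mem_image_of_mem _ (Finset.mem_erase.2 ⟨?_, hx⟩))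
    rintro rfl; exact hia rfl
  have hgT : Sep g T pT := hT.congr hT'
  have hgW : Sep g W pW := hW.congr hW'
  -- `h` on the two subcubes
  obtain ⟨u, hu⟩ : ∃ u, ∀ β, EqOff W β pW → h β = Bool.xor (β b) u := by
    obtain ⟨α, hα, hs⟩ := hgW b hbW
    refine literal_on_subcube hgh.1 (fun i hi hi' => ?_)
      ⟨α, hα, hgh.sens_inner (by simp) hs⟩
    simp only [Finset.mem_insert, Finset.mem_singleton] at hi'
    rcases hi' with rfl | rfl
    · exact absurd hi haW
    · rfl
  obtain ⟨v, hv⟩ : ∃ v, ∀ β : V → Bool, β b = pT b → h β = Bool.xor (β a) v := by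
    obtain ⟨α, hα, hs⟩ := hgT a haT
    obtain ⟨v, hv⟩ := literal_on_subcube (T := T) (p := pT) (t := a) hgh.1 (fun i hi hi' => by
      simp only [Finset.mem_insert, Finset.mem_singleton] at hi'
      rcases hi' with rfl | rfl
      · rfl
      · exact absurd hi hbT) ⟨α, hα, hgh.sens_inner (by simp) hs⟩
    refine ⟨v, fun β hβ => ?_⟩
    rw [hgh.1 β (mix T β pT), hv _ (eqOff_mix _ _ _), mix_mem haT]
    intro i hi
    simp only [Finset.mem_insert, Finset.mem_singleton] at hi
    rcases hi with rfl | rfl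
    · rw [mix_mem haT]
    · rw [mix_notMem hbT, hβ]
  -- the restriction of `g`
  set g₁ : BoolFun V := fun α => g (mix {b} pT α) with hg₁
  have hg₁eq : ∀ α : V → Bool, α b = pT b → g₁ α = g α := fun α hα => by
    simp only [hg₁]; congr 1; funext j
    by_cases hj : j = b
    · rw [mix_mem (by simp [hj]), hj, hα]
    · rw [mix_notMem (by simp [hj])]
  have hfg₁ : ∀ α, EqOff T α pT → f α = g₁ α := fun α hα => by
    rw [hg₁eq α (hα b hbT), hT' α hα]
  have hg₁T : Sep g₁ T pT := hT.congr hfg₁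
  have hro : RO l g₁ (ess g₁) := (hg.mix {b} pT).ro ⟨a, hg₁T.subset_ess haT⟩
  -- `hat` moves the `W`-cube to a `T`-cube: `b` is frozen at `pT b`, and `a` receives the literal
  -- of `b` that keeps the value of `h`, hence that of `g`.
  let hat : (V → Bool) → V → Bool := fun α => fun i =>
    if i = a then Bool.xor (α b) (Bool.xor u v) else if i = b then pT b else α i
  have hat_a : ∀ α, hat α a = Bool.xor (α b) (Bool.xor u v) := fun α => by simp [hat]
  have hat_b : ∀ α, hat α b = pT b := fun α => by simp [hat, hab.symm]
  have hat_ne : ∀ α i, i ≠ a → i ≠ b → hat α i = α i := fun α i h1 h2 => by simp [hat, h1, h2]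
  have hatg : ∀ α, EqOff W α pW → g₁ (hat α) = f α := by
    intro α hα
    rw [hg₁eq _ (hat_b α), hW' α hα]
    refine hgh.2 _ _ (fun i hi => ?_) ?_
    · simp only [Finset.mem_insert, Finset.mem_singleton, not_or] at hi
      exact hat_ne α i hi.1 hi.2
    · rw [hv _ (hat_b α), hu α hα, hat_a]
      cases α b <;> cases u <;> cases v <;> rfl
  have hatT : ∀ α, EqOff W α pW → EqOff T (hat α) (Function.update pW b (pT b)) := by
    intro α hα i hi
    have hia : i ≠ a := fun h => hi (h ▸ haT)
    by_cases hib : i = b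
    · subst hib; rw [hat_b, Function.update_self]
    · rw [hat_ne α i hia hib, Function.update_of_ne hib]
      exact hα i fun hiW => hi (hWT i hiW hib)
  have hflb : ∀ α, hat (flipAt α b) = flipAt (hat α) a := by
    intro α
    funext i
    by_cases hia : i = a
    · subst hia; rw [hat_a, flipAt_self, flipAt_self, hat_a]
      cases α b <;> cases u <;> cases v <;> rfl
    · rw [flipAt_of_ne _ hia]
      by_cases hib : i = b
      · subst hib; rw [hat_b, hat_b]
      · rw [hat_ne _ i hia hib, hat_ne _ i hia hib, flipAt_of_ne _ hib]
  have hfli : ∀ α k, k ≠ a → k ≠ b → hat (flipAt α k) = flipAt (hat α) k := by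
    intro α k hka hkb
    funext i
    by_cases hia : i = a
    · subst hia; rw [hat_a, flipAt_of_ne _ hka.symm, hat_a, flipAt_of_ne _ hkb.symm]
    · by_cases hib : i = b
      · subst hib; rw [hat_b, flipAt_of_ne _ hkb.symm, hat_b]
      · rw [hat_ne _ i hia hib]
        by_cases hik : i = k
        · subst hik; rw [flipAt_self, flipAt_self, hat_ne _ i hia hib]
        · rw [flipAt_of_ne _ hik, flipAt_of_ne _ hik, hat_ne _ i hia hib]
  have hg₁W : Sep g₁ T (Function.update pW b (pT b)) := by
    intro i hi
    by_cases hia : i = a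
    · obtain ⟨α, hα, hs⟩ := hW b hbW
      refine ⟨hat α, hatT α hα, ?_⟩
      unfold Sens at hs ⊢
      rw [hia, ← hflb, hatg _ hα, hatg _ (hα.flip hbW)]
      exact hs
    · have hib : i ≠ b := fun h => hbT (h ▸ hi)
      obtain ⟨α, hα, hs⟩ := hW i (hTW i hi hia)
      refine ⟨hat α, hatT α hα, ?_⟩
      unfold Sens at hs ⊢
      rw [← hfli α i hia hib, hatg _ hα, hatg _ (hα.flip (hTW i hi hia))]
      exact hs
  have hcT : T.card = l := by rw [hTdef, N.card_image hτ (Finset.Subset.refl _), hKl]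
  obtain ⟨α₂, hα₂, hs₂⟩ := hT a haT
  obtain ⟨t₀, ht₀⟩ := hF.exists_xor (hTU haT) hs₂
  replace ht₀ : ∀ β, EqOff T β pT → f β = Bool.xor (comp q e β) t₀ := fun β hβ =>
    ht₀ β ((hβ.trans hα₂.symm).mono hTU)
  have hET : Sep (comp q e) T pT := by
    have := hF.sep_inner hT
    rwa [Finset.inter_eq_left.2 hTU] at this
  -- Rigidity compares two `T`-cubes of `g₁`: the one where it equals `f`, thus `q` up to negations,
  -- and the image of the `W`-cube. Primality of the first projection comes from that of `q`.
  obtain ⟨s₂, t₂, hst⟩ := hro.rigid hl hcT hg₁T hg₁W (fun A hA h hFA => by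
    obtain ⟨h', hh'⟩ := N.fac_of_transversal hτ hET (t := t₀) (fun α hα => by
      rw [← ht₀ α hα, mix_eq_of_eqOff hα]; exact (hfg₁ α hα).symm) hFA
    have hAim : A = (K.filter fun x => τ x ∈ A).image τ := by
      ext i
      simp only [Finset.mem_image, Finset.mem_filter]
      constructor
      · intro hi
        obtain ⟨x, hx, rfl⟩ := Finset.mem_image.1 (hA hi)
        exact ⟨x, ⟨hx, hi⟩, rfl⟩
      · rintro ⟨x, ⟨-, hx⟩, rfl⟩; exact hx
    rcases hprim _ (Finset.filter_subset _ _) h' hh' with h1 | h1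
    · left
      rw [hAim]
      exact Finset.card_image_le.trans h1
    · right
      rw [hAim, h1])
  obtain ⟨s₁, ρT, hρT⟩ := N.realize_transversal hτ hET
  obtain ⟨own, hown⟩ := N.exists_owner
  set s' := Bool.xor (Bool.xor (s₁ x₁) (s₂ a)) (Bool.xor u v) with hs'
  -- The negations collected are those of the branches (`s₁`), of rigidity (`s₂`) and of the
  -- exchange of `a` for `b` (`u`, `v`).
  let ρ : (V → Bool) → V → Bool := fun z i => if i = b then Bool.xor (z x₁) s' else
    if i ∈ W then Bool.xor (z (own i)) (Bool.xor (s₁ (own i)) (s₂ i)) else pW i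
  have hρW : ∀ z, EqOff W (ρ z) pW := fun z i hi => by
    have : i ≠ b := fun h => hi (h ▸ hbW)
    simp only [ρ, this, hi, if_false]
  refine ⟨ρ, s', Bool.xor t₀ t₂, fun z => ⟨hρW z, ?_, by simp [ρ], ?_⟩⟩
  · have h1 := hst (ρT z) (hat (ρ z)) (hρT z).1 (hatT _ (hρW z)) (fun i hi => by
      obtain ⟨x, hx, rfl⟩ := Finset.mem_image.1 hi
      rw [(hρT z).2.1 x hx]
      by_cases hia : τ x = a
      · have : x = x₁ := N.eq_of_mem hx hx₁ (hτ x hx) (hia ▸ hτ x₁ hx₁)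
        subst this
        rw [hat_a]
        simp only [ρ, if_true, hs']
        cases z x <;> cases s₁ x <;> cases s₂ a <;> cases u <;> cases v <;> rfl
      · have hib : τ x ≠ b := fun h => hbT (h ▸ hi)
        rw [hat_ne _ _ hia hib]
        simp only [ρ, hib, if_false, hTW _ hi hia, if_true, hown x hx _ (hτ x hx)]
        cases z x <;> cases s₁ x <;> cases s₂ (τ x) <;> rfl)
    rw [hatg _ (hρW z), ← hfg₁ _ (hρT z).1, ht₀ _ (hρT z).1, (hρT z).2.2.1] at h1
    rw [h1]; cases q z <;> cases t₀ <;> cases t₂ <;> rfl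
  · funext i
    by_cases hib : i = b
    · subst hib
      simp only [ρ, if_true, flipAt_self]
      cases z x₁ <;> cases s' <;> rfl
    · rw [flipAt_of_ne _ hib]
      simp only [ρ, hib, if_false]
      by_cases hiW : i ∈ W
      · have hne : own i ≠ x₁ := by
          obtain ⟨x, hx, rfl⟩ := Finset.mem_image.1 (hWT i hiW hib)
          rw [hown x hx _ (hτ x hx)]
          rintro rfl
          exact haW hiW
        simp only [hiW, if_true, flipAt_of_ne _ hne]
      · simp only [hiW, if_false]

end Rigidity

end CheckingTest
namespace CheckingTest

/-! ### Induction along the path from a binary node down to `a`. -/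

section Path

set_option linter.unusedSectionVars false

variable {V : Type*} [DecidableEq V] [Fintype V]

/-- `f` and `g` agree on relevance hypercubes for all sets of `l` variables admitting one, and
for all robust sets of at most `l` variables; `g` is read-once over `B_l`. -/
structure Compatible (l : ℕ) (f g : BoolFun V) : Prop where
  three_le : 3 ≤ l
  readOnce : IsReadOnce (basisB l) g
  sep : ∀ W, W.card = l → SepEx f W → AgreeOn f g W
  robust : ∀ S ⊆ ess f, S.card ≤ l → Robust f S → AgreeOn f g S

/-- The position of a subfunction `e` with variables `U` inside `f`, relative to a variable `b`
joined to it by a conjunction or a sum modulo 2 (according to `o`). -/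
structure Joined (o : Option Bool) (f : BoolFun V) (b : V) (e : BoolFun V) (U : Finset V) :
    Prop where
  fac : Fac f U e
  notMem : b ∉ U
  sub : insert b U ⊆ ess f
  robust : ∀ S ⊆ U, S.Nonempty → Robust e S → Robust f (insert b S)
  sepEx : ∀ S ⊆ U, S.Nonempty → SepEx e S → SepEx f (insert b S)
  absorb : match o with
    | some _ => ∀ α, Sens f α b → ∃ β, EqOff {b} β α ∧ ∀ γ, EqOff U γ β → f γ = f β
    | none => ∀ α β, EqOff (insert b U) β α → Sens f α b → Sens f β b

lemma Joined.child {o : Option Bool} {f : BoolFun V} {b : V} {K : Finset V} {q : BoolFun V}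
    {e : V → BoolFun V} {U : V → Finset V} (N : Node K q e U)
    (h : Joined o f b (comp q e) (K.biUnion U)) {x : V} (hx : x ∈ K) :
    Joined o f b (e x) (U x) where
  fac := h.fac.trans (N.fac hx) (N.subset hx)
  notMem := fun hb => h.notMem (N.subset hx hb)
  sub := (Finset.insert_subset_insert _ (N.subset hx)).trans h.sub
  robust := fun S hS hne hr =>
    h.robust S (hS.trans (N.subset hx)) hne ((N.fac hx).robust hS hne hr)
  sepEx := fun S hS hne hr => by
    obtain ⟨i, hi⟩ := N.ne x hx
    obtain ⟨α, hα⟩ := N.rel_comp (N.subset hx hi)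
    exact h.sepEx S (hS.trans (N.subset hx)) hne ((N.fac hx).sepEx hS hi hα hr)
  absorb := by
    have := h.absorb
    cases o with
    | some v =>
      intro α hα
      obtain ⟨β, hβ, hγ⟩ := this α hα
      exact ⟨β, hβ, fun γ h => hγ γ (h.mono (N.subset hx))⟩
    | none =>
      exact fun α β hβ => this α β (hβ.mono (Finset.insert_subset_insert _ (N.subset hx)))

/-- Extend `{x}` to a set of `K.card - 1` variables with a hypercube; the omitted variable is `i`.
-/
lemma exists_sepEx_erase {q : BoolFun V} {K : Finset V} (hq : DepOn q K)
    (hr : ∀ x ∈ K, ∃ z, Sens q z x) (h2 : 2 ≤ K.card) {x : V} (hx : x ∈ K) :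
    ∃ i ∈ K, i ≠ x ∧ SepEx q (K.erase i) := by
  have hess : ess q = K :=
    Finset.Subset.antisymm hq.ess_subset fun i hi => mem_ess.2 (hr i hi)
  obtain ⟨z, hz⟩ := hr x hx
  obtain ⟨W, hxW, hW, hWs⟩ := SepEx.extend (S := {x}) ⟨z, sep_singleton hz⟩
    (m := K.card - 1) (by simp; omega) (by rw [hess]; omega)
  have hWK : W ⊆ K := hess ▸ hWs.choose_spec.subset_ess
  obtain ⟨i, hi, hiW⟩ : ∃ i ∈ K, i ∉ W := by
    by_contra! h
    have := Finset.card_le_card (show K ⊆ W from h)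
    omega
  refine ⟨i, hi, fun h => hiW (h ▸ hxW (by simp)), ?_⟩
  have : W = K.erase i := Finset.eq_of_subset_of_card_le
    (fun j hj => Finset.mem_erase.2 ⟨fun h => hiW (h ▸ hj), hWK hj⟩)
    (by rw [Finset.card_erase_of_mem hi]; omega)
  rwa [← this]

/-- If `{a, b}` is a module of `g` and `b` is joined to a subfunction `E` of `f` containing `a`,
then `E` depends on `a` in the same way as `g` does. -/
theorem RO.lin {l : ℕ} {f g h E : BoolFun V} {U : Finset V} {a b : V} {o : Option Bool}
    (H : Compatible l f g) (hro : RO l E U) (ha : a ∈ U) (hJ : Joined o f b E U)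
    (hgh : Fac g {a, b} h) (hG : PairType o g a b) (p : V → Bool) :
    Lin o E a Finset.univ p := by
  have hu : ∀ α p : V → Bool, EqOff Finset.univ α p := fun α p j hj => by simp at hj
  induction hro with
  | leaf x s =>
    rw [Finset.mem_singleton] at ha
    subst ha
    cases o with
    | some v => exact fun α β _ _ hα hβ => by simp only [hα, hβ]
    | none => exact fun α _ => sens_leaf _ _ _
  | node K q e U N h2 hlK hpr he ih =>
    obtain ⟨x₁, hx₁, hax₁⟩ := Finset.mem_biUnion.1 ha
    have hlin₁ := ih x₁ hx₁ hax₁ (hJ.child N hx₁)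
    obtain ⟨τ, hτ, hτa⟩ : ∃ τ : V → V, (∀ x ∈ K, τ x ∈ U x) ∧ τ x₁ = a := by
      have : ∀ x, ∃ t, x ∈ K → t ∈ U x := fun x => by
        by_cases hx : x ∈ K
        · exact ⟨_, fun _ => (N.ne x hx).choose_spec⟩
        · exact ⟨x, fun h => absurd h hx⟩
      choose τ hτ using this
      refine ⟨Function.update τ x₁ a, fun x hx => ?_, Function.update_self _ _ _⟩
      by_cases hxx : x = x₁
      · subst hxx; rwa [Function.update_self]
      · rw [Function.update_of_ne hxx]; exact hτ x hx
    subst hτa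
    have hsubU : ∀ J ⊆ K, J.image τ ⊆ K.biUnion U := fun J hJ => N.image_subset hτ hJ
    have hbim : ∀ J ⊆ K, b ∉ J.image τ := fun J hJK h => hJ.notMem (hsubU J hJK h)
    have hqlin : ∀ J ⊆ K, x₁ ∈ J → AgreeOn f g (insert b (J.image τ)) →
        ∃ c, Lin (o.map fun v => e x₁ fun _ => v) q x₁ J c ∧ Sep q J c := by
      intro J hJK hx₁J hA
      have haJ : τ x₁ ∈ insert b (J.image τ) :=
        Finset.mem_insert_of_mem (Finset.mem_image_of_mem _ hx₁J)
      obtain ⟨p', hp', hs⟩ := lin_of_agreeOn hJ.fac hJ.notMem ha haJ (Finset.mem_insert_self _ _)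
        (Finset.insert_subset_insert _ (hsubU J hJK)) hA hG
      exact N.lin_q hτ hJK hx₁J hJ.notMem hp' (fun x hx => hs _
        (Finset.mem_insert_of_mem (Finset.mem_image_of_mem _ hx))
        (hsubU J hJK (Finset.mem_image_of_mem _ hx))) hlin₁
    refine N.lin_comp hx₁ hax₁ hlin₁ (p₂ := p) ?_
    have himne : ∀ J : Finset V, J.card ≠ 0 → (J.image τ).Nonempty := fun J hJ => by
      rw [Finset.image_nonempty]
      exact Finset.card_pos.1 (by omega)
    -- With fewer than `l` branches, a full transversal together with `b` has at most `l` elements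
    -- and is robust.
    rcases hlK.lt_or_eq with hlt | hKl
    · obtain ⟨c, hc, -⟩ := hqlin K (Finset.Subset.refl _) hx₁ (H.robust _
        ((Finset.insert_subset_insert _ (hsubU K (Finset.Subset.refl _))).trans hJ.sub)
        (by
          rw [Finset.card_insert_of_notMem (hbim K (Finset.Subset.refl _)),
            N.card_image hτ (Finset.Subset.refl _)]
          omega)
        (hJ.robust _ (hsubU K (Finset.Subset.refl _)) (himne K (by omega))
          (N.robust_image hτ)))
      exact hc.univ_of_depOn N.dep hx₁
    · have hl3 := H.three_le
      have hprim : Prim q K := hpr.resolve_left (by omega)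
      -- With `l` branches one branch must be omitted to make room for `b`. The resulting set need
      -- not be robust, but it has exactly `l` elements, so having a hypercube suffices.
      have hE : ∀ i ∈ K, i ≠ x₁ → SepEx q (K.erase i) →
          ∃ c, Lin (o.map fun v => e x₁ fun _ => v) q x₁ (K.erase i) c ∧
            Sep q (K.erase i) c := by
        intro i hi hix hs
        have hiK := Finset.erase_subset i K
        have hci : (K.erase i).card = l - 1 := by rw [Finset.card_erase_of_mem hi, hKl]
        refine hqlin _ hiK (Finset.mem_erase.2 ⟨hix.symm, hx₁⟩) (H.sep _ ?_
          (hJ.sepEx _ (hsubU _ hiK) (himne _ (by omega)) (N.sepEx_image hτ hiK hs)))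
        rw [Finset.card_insert_of_notMem (hbim _ hiK), N.card_image hτ hiK, hci]
        omega
      obtain ⟨i, hi, hix, his⟩ := exists_sepEx_erase N.dep N.rel h2 hx₁
      obtain ⟨c, hc, hcs⟩ := hE i hi hix his
      -- This gives a hypercube to the transversal with `a` replaced by `b`, as needed for the
      -- transport.
      have hx₁s : SepEx q (K.erase x₁) := by
        obtain ⟨j, hj, hji, hjs⟩ := exists_sepEx_erase N.dep N.rel h2 hi
        by_cases hjx : j = x₁
        · rwa [← hjx]
        · obtain ⟨d, hd, hds⟩ := hE j hj hjx hjs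
          exact sepEx_erase_of_lin N.dep hx₁ hji.symm hc hcs hd hds hix.symm (Ne.symm hjx)
      have hxK := Finset.erase_subset x₁ K
      have hcx : (K.erase x₁).card = l - 1 := by rw [Finset.card_erase_of_mem hx₁, hKl]
      obtain ⟨pW, hW, hW'⟩ := H.sep (insert b ((K.erase x₁).image τ))
        (by
          rw [Finset.card_insert_of_notMem (hbim _ hxK), N.card_image hτ hxK, hcx]
          omega)
        (hJ.sepEx _ (hsubU _ hxK) (himne _ (by omega)) (N.sepEx_image hτ hxK hx₁s))
      obtain ⟨pT, hT, hT'⟩ := H.robust (K.image τ)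
        ((hsubU K (Finset.Subset.refl _)).trans
          ((Finset.subset_insert _ _).trans hJ.sub))
        (by rw [N.card_image hτ (Finset.Subset.refl _), hKl])
        (hJ.fac.robust (hsubU K (Finset.Subset.refl _)) (himne K (by omega))
          (N.robust_image hτ))
      obtain ⟨ρ, s, t, hρ⟩ := N.exists_transport hl3 hKl hprim hτ hx₁ rfl rfl hJ.fac hJ.notMem
        H.readOnce hgh hT hT' hW hW'
      obtain ⟨α₁, hα₁, hs₁⟩ := hW b (Finset.mem_insert_self _ _)
      have hWU : insert b ((K.erase x₁).image τ) ⊆ insert b (K.biUnion U) :=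
        Finset.insert_subset_insert _ (hsubU _ hxK)
      have habs := hJ.absorb
      cases o with
      | none =>
        intro z _
        have := habs α₁ (ρ z) (((hρ z).1.trans hα₁.symm).mono hWU) hs₁
        unfold Sens at this ⊢
        rw [(hρ z).2.1, (hρ (flipAt z x₁)).2.1, (hρ z).2.2.2]
        simpa using this
      | some v =>
        obtain ⟨β, hβ, hγ⟩ := habs α₁ hs₁
        -- In the transported cube `b` stands for `x₁`, and one value of `b` absorbs all of `U`.
        have hconst : ∀ z z', z x₁ = Bool.xor (β b) s → z' x₁ = Bool.xor (β b) s →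
            q z = q z' := by
          have : ∀ z, z x₁ = Bool.xor (β b) s → q z = Bool.xor (f β) t := by
            intro z hz
            rw [(hρ z).2.1, hγ (ρ z)]
            intro j hj
            by_cases hjb : j = b
            · rw [hjb, (hρ z).2.2.1, hz]; cases β b <;> cases s <;> rfl
            · have hjW : j ∉ insert b ((K.erase x₁).image τ) := fun h =>
                (Finset.mem_insert.1 (hWU h)).elim hjb hj
              rw [(hρ z).1 j hjW, hβ j (by simpa using hjb), hα₁ j hjW]
          exact fun z z' hz hz' => by rw [this z hz, this z' hz']
        simp only [Option.map_some] at hc ⊢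
        generalize e x₁ (fun _ => v) = κ at hc ⊢
        by_cases hκ : Bool.xor (β b) s = κ
        · rw [hκ] at hconst
          exact fun z z' _ _ hz hz' => hconst z z' hz hz'
        -- Otherwise `q` would be constant for each value of `x₁` on the cube for `K.erase i`,
        -- although it depends there on a further variable `k`; such `k` exists because `l ≥ 3`.
        · exfalso
          obtain ⟨k, hk, hkx⟩ : ∃ k ∈ K.erase i, k ≠ x₁ := by
            refine Finset.exists_mem_ne ?_ x₁
            rw [Finset.card_erase_of_mem hi]; omega
          obtain ⟨z, hz, hzs⟩ := hcs k hk
          apply hzs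
          have hfx : flipAt z k x₁ = z x₁ := flipAt_of_ne _ hkx.symm
          by_cases hzκ : z x₁ = κ
          · exact hc _ _ (hz.flip hk) hz (by rw [hfx, hzκ]) hzκ
          · have : z x₁ = Bool.xor (β b) s := by
              revert hzκ hκ
              cases z x₁ <;> cases κ <;> cases Bool.xor (β b) s <;> simp
            exact hconst _ _ (by rw [hfx, this]) this

end Path

end CheckingTest
namespace CheckingTest

/-! ### Two-element modules across a binary node. -/

section Pairs

set_option linter.unusedSectionVars false

variable {V : Type*} [DecidableEq V] [Fintype V]

lemma Fac.pair_type {g h : BoolFun V} {a b : V} (hab : a ≠ b) (hF : Fac g {a, b} h)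
    (ha : ∃ α, Sens g α a) (hb : ∃ α, Sens g α b) :
    (∃ u v, PairType (some u) g a b ∧ PairType (some v) g b a) ∨ PairType none g a b := by
  let H : Bool → Bool → Bool := fun x y => h fun i => if i = a then x else y
  have hH : ∀ α, h α = H (α a) (α b) := fun α => hF.1 _ _ fun i hi => by
    simp only [Finset.mem_insert, Finset.mem_singleton] at hi
    rcases hi with rfl | rfl
    · simp
    · simp [hab.symm]
  have hHa : ∀ α, h (flipAt α a) = H (!α a) (α b) := fun α => by
    rw [hH, flipAt_self, flipAt_of_ne _ hab.symm]
  have hHb : ∀ α, h (flipAt α b) = H (α a) (!α b) := fun α => by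
    rw [hH, flipAt_self, flipAt_of_ne _ hab]
  have h1 : ∃ x y, H (!x) y ≠ H x y := by
    obtain ⟨α, hα⟩ := ha
    have := hF.sens_inner (by simp) hα
    unfold Sens at this
    rw [hHa, hH] at this
    exact ⟨_, _, this⟩
  have h2 : ∃ x y, H x (!y) ≠ H x y := by
    obtain ⟨α, hα⟩ := hb
    have := hF.sens_inner (by simp) hα
    unfold Sens at this
    rw [hHb, hH] at this
    exact ⟨_, _, this⟩
  -- A binary function depending on both arguments is a conjunction up to negations, or a sum; all
  -- sixteen functions are checked.
  have h3 : (∃ u v, (∀ y, H u (!y) = H u y) ∧ ∀ x, H (!x) v = H x v) ∨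
      ∀ x y, H (!x) (!y) = H x y := by
    revert h1 h2
    generalize H = H'
    revert H'
    decide
  rcases h3 with ⟨u, v, hu, hv⟩ | h3
  · refine Or.inl ⟨u, v, fun α hα hs => ?_, fun α hα hs => ?_⟩
    · apply hF.sens_inner (by simp) hs
      rw [hHb, hH, hα, hu]
    · apply hF.sens_inner (by simp) hs
      rw [hHa, hH, hα, hv]
  · refine Or.inr fun α => hF.2 _ _ (fun j hj => ?_) ?_
    · simp only [Finset.mem_insert, Finset.mem_singleton, not_or] at hj
      rw [flipAt_of_ne _ hj.2, flipAt_of_ne _ hj.1]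
    · rw [hHb, hH, flipAt_self, flipAt_of_ne _ hab.symm, h3]

lemma PairType.symm_none {g : BoolFun V} {a b : V} (h : PairType none g a b) :
    PairType none g b a := fun α => by
  rw [flipAt_comm]; exact h α

namespace Node

variable {K : Finset V} {q : BoolFun V} {e : V → BoolFun V} {U : V → Finset V}

/-- The restriction to a subcube `{a, b}` whose free variables lie in the two branches of a binary
node. -/
lemma binary_shape (N : Node K q e U) {f g : BoolFun V} {x y a b : V} (hK : K = {x, y})
    (hxy : x ≠ y) (ha : a ∈ U x) (hb : b ∈ U y) (hF : Fac f (K.biUnion U) (comp q e))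
    (hA : AgreeOn f g {a, b}) :
    ∃ (ρ : (V → Bool) → V → Bool) (s s' t : Bool), ∀ z, ρ z a = Bool.xor (z x) s ∧
      ρ z b = Bool.xor (z y) s' ∧ e x (ρ z) = z x ∧ e y (ρ z) = z y ∧
      g (ρ z) = Bool.xor (q z) t ∧ ρ (flipAt z x) = flipAt (ρ z) a ∧
      ρ (flipAt z y) = flipAt (ρ z) b := by
  have hxK : x ∈ K := by simp [hK]
  have hyK : y ∈ K := by simp [hK]
  have hab : a ≠ b := fun h => hxy (N.eq_of_mem hxK hyK ha (h ▸ hb))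
  let τ : V → V := fun k => if k = x then a else b
  have hτx : τ x = a := by simp [τ]
  have hτy : τ y = b := by simp [τ, hxy.symm]
  have hτ : ∀ k ∈ K, τ k ∈ U k := fun k hk => by
    rw [hK] at hk
    simp only [Finset.mem_insert, Finset.mem_singleton] at hk
    rcases hk with rfl | rfl
    · rwa [hτx]
    · rwa [hτy]
  have hT : K.image τ = {a, b} := by
    rw [hK, Finset.image_insert, Finset.image_singleton, hτx, hτy]
  have hTU : ({a, b} : Finset V) ⊆ K.biUnion U :=
    hT ▸ N.image_subset hτ (Finset.Subset.refl _)
  obtain ⟨p, hsep, hfg⟩ := hA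
  have hEs : Sep (comp q e) (K.image τ) p := by
    have := hF.sep_inner hsep
    rwa [Finset.inter_eq_left.2 hTU, ← hT] at this
  obtain ⟨s, ρ, hρ⟩ := N.realize_transversal hτ hEs
  obtain ⟨α, hα, hs⟩ := hsep a (by simp)
  obtain ⟨t, ht⟩ := hF.exists_xor (hTU (by simp)) hs
  have hcube : ∀ z, EqOff {a, b} (ρ z) p := fun z => hT ▸ (hρ z).1
  have hρa : ∀ z, ρ z a = Bool.xor (z x) (s x) := fun z => by
    have := (hρ z).2.1 x hxK
    rwa [hτx] at this
  have hρb : ∀ z, ρ z b = Bool.xor (z y) (s y) := fun z => by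
    have := (hρ z).2.1 y hyK
    rwa [hτy] at this
  refine ⟨ρ, s x, s y, t, fun z => ⟨hρa z, hρb z, (hρ z).2.2.2 x hxK, (hρ z).2.2.2 y hyK, ?_,
    ?_, ?_⟩⟩
  · rw [← hfg _ (hcube z), ht _ (((hcube z).trans hα.symm).mono hTU), (hρ z).2.2.1]
  · funext i
    by_cases hia : i = a
    · subst hia; rw [flipAt_self, hρa, hρa, flipAt_self]; simp
    · rw [flipAt_of_ne _ hia]
      by_cases hib : i = b
      · subst hib; rw [hρb, hρb, flipAt_of_ne _ hxy.symm]
      · rw [hcube _ i (by simp [hia, hib]), hcube _ i (by simp [hia, hib])]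
  · funext i
    by_cases hib : i = b
    · subst hib; rw [flipAt_self, hρb, hρb, flipAt_self]; simp
    · rw [flipAt_of_ne _ hib]
      by_cases hia : i = a
      · subst hia; rw [hρa, hρa, flipAt_of_ne _ hxy]
      · rw [hcube _ i (by simp [hia, hib]), hcube _ i (by simp [hia, hib])]

/-- The point is to verify `Joined` and invoke `RO.lin`. In the branch of `y` the set `{b}` is
robust by itself, so `b` may be adjoined to any robust set of the other branch. The hypothesis `hq`
on `q` supplies `absorb`. -/
lemma lin_branch (N : Node K q e U) {l : ℕ} {f g h : BoolFun V} {x y a b : V}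
    (H : Compatible l f g) (hK : K = {x, y}) (hxy : x ≠ y) (ha : a ∈ U x) (hb : b ∈ U y)
    (hF : Fac f (K.biUnion U) (comp q e)) (hsub : K.biUnion U ⊆ ess f)
    (hro : RO l (e x) (U x)) (hgh : Fac g {a, b} h) {o : Option Bool} (hG : PairType o g a b)
    (hq : match o with
      | some _ => ∃ κ, ∀ z, z y = κ → ¬ Sens q z x
      | none => ∀ z, Sens q z y) (p : V → Bool) : Lin o (e x) a Finset.univ p := by
  have hxK : x ∈ K := by simp [hK]
  have hyK : y ∈ K := by simp [hK]
  have hbx : b ∉ U x := fun h => hxy (N.eq_of_mem hxK hyK h hb)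
  have hbU : b ∈ K.biUnion U := N.subset hyK hb
  have hinter : ∀ S ⊆ U x, insert b S ∩ U x = S ∧ insert b S ∩ U y = {b} := by
    intro S hS
    constructor
    · rw [Finset.insert_inter_of_notMem hbx, Finset.inter_eq_left.2 hS]
    · rw [Finset.insert_inter_of_mem hb]
      have : S ∩ U y = ∅ := Finset.disjoint_iff_inter_eq_empty.1
        (Finset.disjoint_of_subset_left hS (N.disj x hxK y hyK hxy))
      rw [this]; rfl
  have hins : ∀ S ⊆ U x, insert b S ⊆ K.biUnion U := fun S hS =>
    Finset.insert_subset hbU (hS.trans (N.subset hxK))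
  obtain ⟨α₀, hα₀⟩ := mem_ess.1 (hsub hbU)
  refine hro.lin H ha (b := b) ⟨hF.trans (N.fac hxK) (N.subset hxK), hbx, (hins _
    (Finset.Subset.refl _)).trans hsub, fun S hS hne hr => ?_, fun S hS hne hr => ?_, ?_⟩ hgh hG p
  · refine hF.robust (hins S hS) (by simp) (N.robust (hins S hS) fun k hk => ?_)
    rw [hK] at hk
    simp only [Finset.mem_insert, Finset.mem_singleton] at hk
    rcases hk with rfl | rfl
    · rw [(hinter S hS).1]; exact ⟨hne, hr⟩
    · rw [(hinter S hS).2]; exact ⟨by simp, robust_singleton _ _⟩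
  · refine hF.sepEx (hins S hS) hbU hα₀ (N.sepEx (Finset.Subset.refl K) ⟨α₀, N.sep_q _⟩
      (hins S hS) (fun k hk => ?_) fun k hk hk' => absurd hk hk')
    rw [hK] at hk
    simp only [Finset.mem_insert, Finset.mem_singleton] at hk
    rcases hk with rfl | rfl
    · rw [(hinter S hS).1]; exact ⟨hne, hr⟩
    · rw [(hinter S hS).2]
      obtain ⟨α, hα⟩ := N.erel _ hyK b hb
      exact ⟨by simp, α, sep_singleton hα⟩
  · have hFy := hF.trans (N.fac hyK) (N.subset hyK)
    cases o with
    | some v =>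
      obtain ⟨κ, hκ⟩ := hq
      intro α hα
      obtain ⟨β, hβ, hβκ⟩ := (hFy.sens_inner hb hα).exists_value κ
      refine ⟨β, hβ, fun γ hγ => hF.2 _ _ (hγ.mono (N.subset hxK)) ?_⟩
      have hyγ : e y γ = e y β := N.edep y hyK _ _ fun j hj => hγ j fun hjx =>
        hxy (N.eq_of_mem hxK hyK hjx hj)
      by_cases hx : e x γ = e x β
      · exact (N.fac hxK).2 _ _ hγ hx
      · have := hκ (fun k => e k β) hβκ
        unfold Sens at this
        push Not at this
        refine Eq.trans (N.dep _ _ fun k hk => ?_) this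
        rw [hK] at hk
        simp only [Finset.mem_insert, Finset.mem_singleton] at hk
        rcases hk with rfl | rfl
        · rw [flipAt_self]; revert hx; cases e k γ <;> cases e k β <;> simp
        · rw [flipAt_of_ne _ hxy.symm, hyγ]
    | none =>
      intro α β hβ hα
      have h1 := hFy.sens_inner hb hα
      have h2 : Sens (e y) (mix (U y) β α) b := h1.of_eqOff_single fun j hj => by
        by_cases hjy : j ∈ U y
        · rw [mix_mem hjy]
          refine hβ j ?_
          simp only [Finset.mem_insert, not_or]
          exact ⟨by simpa using hj, fun hjx => hxy (N.eq_of_mem hxK hyK hjx hjy)⟩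
        · rw [mix_notMem hjy]
      have h3 : Sens (e y) β b := (N.edep y hyK).sens h2 fun j hj => (mix_mem hj _ _).symm
      exact hF.sens_outer hbU hα (hβ.mono (hins _ (Finset.Subset.refl _))) hbU
        ((N.sens_iff hyK hb).2 ⟨hq _, h3⟩)

/-- A two-element module of `g` meeting both branches of a binary node of `f` is a module
of `f`. -/
lemma pair_module (N : Node K q e U) {l : ℕ} {f g h : BoolFun V} {x y a b : V}
    (H : Compatible l f g) (hK : K = {x, y}) (hxy : x ≠ y) (ha : a ∈ U x) (hb : b ∈ U y)
    (hF : Fac f (K.biUnion U) (comp q e)) (hsub : K.biUnion U ⊆ ess f)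
    (hro : ∀ k ∈ K, RO l (e k) (U k)) (hgh : Fac g {a, b} h) (hA : AgreeOn f g {a, b}) :
    ∃ h', Fac f {a, b} h' := by
  have hxK : x ∈ K := by simp [hK]
  have hyK : y ∈ K := by simp [hK]
  have hab : a ≠ b := fun h => hxy (N.eq_of_mem hxK hyK ha (h ▸ hb))
  have hu : ∀ α p : V → Bool, EqOff Finset.univ α p := fun α p j hj => by simp at hj
  have habU : ({a, b} : Finset V) ⊆ K.biUnion U := by
    intro i hi
    simp only [Finset.mem_insert, Finset.mem_singleton] at hi
    rcases hi with rfl | rfl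
    · exact N.subset hxK ha
    · exact N.subset hyK hb
  suffices hE : ∃ h', Fac (comp q e) {a, b} h' by
    obtain ⟨h', hh'⟩ := hE
    exact ⟨h', hF.trans hh' habU⟩
  obtain ⟨p, hsep, hfg⟩ := id hA
  have hgs := hsep.congr hfg
  obtain ⟨α₁, -, hα₁⟩ := hgs a (by simp)
  obtain ⟨α₂, -, hα₂⟩ := hgs b (by simp)
  obtain ⟨ρ, s, s', t, hρ⟩ := N.binary_shape hK hxy ha hb hF hA
  have hK' : K = {y, x} := by rw [hK, Finset.pair_comm]
  have hgh' : Fac g {b, a} h := by rwa [Finset.pair_comm]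
  rcases hgh.pair_type hab ⟨_, hα₁⟩ ⟨_, hα₂⟩ with ⟨u, v, hu1, hv1⟩ | hnone
  -- On the common cube for `{a, b}`, `q` is `g` up to negations and so inherits its type.
  · have hqx : ∀ z, z x = Bool.xor u s → ¬ Sens q z y := by
      intro z hz hs
      obtain ⟨h1, -, -, -, h5, -, h7⟩ := hρ z
      apply hu1 (ρ z) (by rw [h1, hz]; cases u <;> cases s <;> rfl)
      unfold Sens at hs ⊢
      rw [← h7, h5, (hρ _).2.2.2.2.1]
      simpa using hs
    have hqy : ∀ z, z y = Bool.xor v s' → ¬ Sens q z x := by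
      intro z hz hs
      obtain ⟨-, h2, -, -, h5, h6, -⟩ := hρ z
      apply hv1 (ρ z) (by rw [h2, hz]; cases v <;> cases s' <;> rfl)
      unfold Sens at hs ⊢
      rw [← h6, h5, (hρ _).2.2.2.2.1]
      simpa using hs
    have hlx := N.lin_branch H hK hxy ha hb hF hsub (hro x hxK) hgh hu1 ⟨_, hqy⟩ p
    have hly := N.lin_branch H hK' hxy.symm hb ha hF hsub (hro y hyK) hgh' hv1 ⟨_, hqx⟩ p
    let z₀ : V → Bool := fun k => if k = x then Bool.xor u s else Bool.xor v s'
    have hz₀x : z₀ x = Bool.xor u s := by simp [z₀]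
    have hz₀y : z₀ y = Bool.xor v s' := by simp [z₀, hxy.symm]
    have hex : ∀ α, α a = u → e x α = Bool.xor u s := by
      intro α hα
      rw [← hz₀x, ← (hρ z₀).2.2.1]
      exact hlx _ _ (hu _ _) (hu _ _) hα (by
        rw [(hρ z₀).1, hz₀x]; cases u <;> cases s <;> rfl)
    have hey : ∀ α, α b = v → e y α = Bool.xor v s' := by
      intro α hα
      rw [← hz₀y, ← (hρ z₀).2.2.2.1]
      exact hly _ _ (hu _ _) (hu _ _) hα (by
        rw [(hρ z₀).2.1, hz₀y]; cases v <;> cases s' <;> rfl)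
    have hz : ∀ z, (z x = z₀ x ∨ z y = z₀ y) → q z = q z₀ := by
      intro z hz
      by_cases h1 : z x = z₀ x
      · by_cases h2 : z y = z₀ y
        · refine N.dep _ _ fun k hk => ?_
          rw [hK] at hk
          simp only [Finset.mem_insert, Finset.mem_singleton] at hk
          rcases hk with rfl | rfl <;> assumption
        · have := hqx z₀ hz₀x
          unfold Sens at this
          push Not at this
          rw [← this]
          refine N.dep _ _ fun k hk => ?_
          rw [hK] at hk
          simp only [Finset.mem_insert, Finset.mem_singleton] at hk
          rcases hk with rfl | rfl
          · rw [flipAt_of_ne _ hxy, h1]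
          · rw [flipAt_self]; revert h2; cases z k <;> cases z₀ k <;> simp
      · have h2 : z y = z₀ y := hz.resolve_left h1
        have := hqy z₀ hz₀y
        unfold Sens at this
        push Not at this
        rw [← this]
        refine N.dep _ _ fun k hk => ?_
        rw [hK] at hk
        simp only [Finset.mem_insert, Finset.mem_singleton] at hk
        rcases hk with rfl | rfl
        · rw [flipAt_self]; revert h1; cases z k <;> cases z₀ k <;> simp
        · rw [flipAt_of_ne _ hxy.symm, h2]
    have hE : ∀ α : V → Bool, (α a = u ∨ α b = v) → comp q e α = q z₀ := by
      rintro α (hα | hα)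
      · exact hz _ (Or.inl (by rw [hex α hα, hz₀x]))
      · exact hz _ (Or.inr (by rw [hey α hα, hz₀y]))
    -- Where this bit is true the composition is constant; where it is false both `a` and `b` are
    -- determined.
    refine ⟨fun α => decide (α a = u ∨ α b = v), fun α β hαβ => ?_, fun α β hαβ hh => ?_⟩
    · simp only [hαβ a (by simp), hαβ b (by simp)]
    · by_cases hα : α a = u ∨ α b = v
      · have hβ : β a = u ∨ β b = v := by simpa [hα] using hh
        rw [hE α hα, hE β hβ]
      · have hβ : ¬ (β a = u ∨ β b = v) := by simpa [hα] using hh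
        congr 1
        funext j
        by_cases hja : j = a
        · subst hja
          push Not at hα hβ
          have h1 := hα.1
          have h2 := hβ.1
          revert h1 h2; cases α j <;> cases β j <;> cases u <;> simp
        · by_cases hjb : j = b
          · subst hjb
            push Not at hα hβ
            have h1 := hα.2
            have h2 := hβ.2
            revert h1 h2; cases α j <;> cases β j <;> cases v <;> simp
          · exact hαβ j (by simp [hja, hjb])
  · have hq2 : ∀ z, q (flipAt (flipAt z x) y) = q z := by
      intro z
      have h1 := hnone (ρ z)
      rw [← (hρ z).2.2.2.2.2.1, ← (hρ _).2.2.2.2.2.2, (hρ _).2.2.2.2.1, (hρ _).2.2.2.2.1] at h1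
      simpa using h1
    -- Invariance under flipping both inputs carries one sensitive point of `q` to both values of
    -- the other input, so `q` is sensitive everywhere.
    have hmove : ∀ k k' : V, k ∈ K → K = {k, k'} → k ≠ k' →
        (∀ z, q (flipAt (flipAt z k') k) = q z) → ∀ z, Sens q z k := by
      intro k k' hk hKk hkk hq2 z
      obtain ⟨w, hw⟩ := N.rel k hk
      have hw' : Sens q (flipAt w k') k := by
        have h1 := hq2 (flipAt w k)
        rw [flipAt_comm, flipAt_flipAt] at h1
        unfold Sens at hw ⊢
        rw [hq2 w, h1]
        exact hw.symm
      have : ∃ w', w' k' = z k' ∧ Sens q w' k := by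
        by_cases h : w k' = z k'
        · exact ⟨w, h, hw⟩
        · exact ⟨_, by rw [flipAt_self]; revert h; cases w k' <;> cases z k' <;> simp, hw'⟩
      obtain ⟨w', h1, h2⟩ := this
      have h3 : Sens q (fun j => if j = k then z k else w' j) k :=
        h2.of_eqOff_single fun j hj => by
          have : j ≠ k := by simpa using hj
          simp [this]
      refine N.dep.sens h3 fun j hj => ?_
      rw [hKk] at hj
      simp only [Finset.mem_insert, Finset.mem_singleton] at hj
      rcases hj with rfl | rfl
      · simp
      · simp [hkk.symm, h1]
    have hsx : ∀ z, Sens q z x := hmove x y hxK hK hxy fun z => by rw [flipAt_comm]; exact hq2 z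
    have hsy : ∀ z, Sens q z y := hmove y x hyK hK' hxy.symm hq2
    have hlx := N.lin_branch H hK hxy ha hb hF hsub (hro x hxK) hgh hnone hsy p
    have hly := N.lin_branch H hK' hxy.symm hb ha hF hsub (hro y hyK) hgh' hnone.symm_none hsx p
    have hE : ∀ α, comp q e (flipAt (flipAt α a) b) = comp q e α := by
      intro α
      refine Eq.trans (N.dep _ _ fun k hk => ?_) (hq2 fun k => e k α)
      rw [hK] at hk
      simp only [Finset.mem_insert, Finset.mem_singleton] at hk
      rcases hk with rfl | rfl
      · rw [flipAt_of_ne _ hxy, flipAt_self]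
        have h1 : e k (flipAt (flipAt α a) b) = e k (flipAt α a) := N.edep k hxK _ _ fun j hj =>
          flipAt_of_ne _ fun h => hxy (N.eq_of_mem hxK hyK (h ▸ hj) hb)
        have h2 := hlx α (hu _ _)
        unfold Sens at h2
        rw [h1]; revert h2; cases e k (flipAt α a) <;> cases e k α <;> simp
      · rw [flipAt_self, flipAt_of_ne _ hxy.symm]
        have h1 : e k (flipAt (flipAt α a) b) = e k (flipAt α b) := by
          rw [flipAt_comm]
          exact N.edep k hyK _ _ fun j hj =>
            flipAt_of_ne _ fun h => hxy (N.eq_of_mem hxK hyK ha (h ▸ hj))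
        have h2 := hly α (hu _ _)
        unfold Sens at h2
        rw [h1]; revert h2; cases e k (flipAt α b) <;> cases e k α <;> simp
    refine ⟨fun α => Bool.xor (α a) (α b), fun α β hαβ => ?_, fun α β hαβ hh => ?_⟩
    · simp only [hαβ a (by simp), hαβ b (by simp)]
    · by_cases hja : α a = β a
      · have hjb : α b = β b := by
          revert hh; simp only [hja]; simp
        congr 1
        funext j
        by_cases h1 : j = a
        · rw [h1, hja]
        · by_cases h2 : j = b
          · rw [h2, hjb]
          · exact hαβ j (by simp [h1, h2])
      · have : α = flipAt (flipAt β a) b := by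
          funext j
          by_cases h1 : j = a
          · subst h1
            rw [flipAt_of_ne _ hab, flipAt_self]
            revert hja; cases α j <;> cases β j <;> simp
          · by_cases h2 : j = b
            · subst h2
              rw [flipAt_self, flipAt_of_ne _ hab.symm]
              have hh' : Bool.xor (α a) (α j) = Bool.xor (β a) (β j) := hh
              revert hja hh'
              cases α a <;> cases β a <;> cases α j <;> cases β j <;> simp
            · rw [flipAt_of_ne _ h2, flipAt_of_ne _ h1]
              exact hαβ j (by simp [h1, h2])
        rw [this, hE]

end Node

end Pairs

end CheckingTest
namespace CheckingTest

/-! ### Modules of `g` become modules of `f`. -/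

section Transfer

set_option linter.unusedSectionVars false

variable {V : Type*} [DecidableEq V] [Fintype V]

namespace Node

variable {K : Finset V} {q : BoolFun V} {e : V → BoolFun V} {U : V → Finset V}

/-- The transversal is robust and has at most `l` elements, so on one of its hypercubes `g = f` is
`q` up to negations. The trace of `A` there is a module of the prime `q`. -/
lemma card_filter_of_module (N : Node K q e U) {l : ℕ} {f g h : BoolFun V} {A : Finset V}
    (H : Compatible l f g) (hne : K.Nonempty) (hl : K.card ≤ l) (hp : Prim q K)
    (hF : Fac f (K.biUnion U) (comp q e)) (hsub : K.biUnion U ⊆ ess f) (hA : Fac g A h)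
    {τ : V → V} (hτ : ∀ x ∈ K, τ x ∈ U x) :
    (K.filter fun x => τ x ∈ A).card ≤ 1 ∨ (K.filter fun x => τ x ∈ A) = K := by
  have hTU := N.image_subset hτ (Finset.Subset.refl K)
  obtain ⟨x, hx⟩ := hne
  have hxT : τ x ∈ K.image τ := Finset.mem_image_of_mem _ hx
  obtain ⟨p, hsep, hfg⟩ := H.robust (K.image τ) (hTU.trans hsub)
    (by rwa [N.card_image hτ (Finset.Subset.refl K)])
    (hF.robust hTU ⟨_, hxT⟩ (N.robust_image hτ))
  obtain ⟨α, hα, hs⟩ := hsep _ hxT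
  obtain ⟨t, ht⟩ := hF.exists_xor (hTU hxT) hs
  have hE : Sep (comp q e) (K.image τ) p := by
    have := hF.sep_inner hsep
    rwa [Finset.inter_eq_left.2 hTU] at this
  obtain ⟨h', hh'⟩ := N.fac_of_transversal hτ hE (t := t) (fun β hβ => by
    rw [← hfg _ hβ, ht _ ((hβ.trans hα.symm).mono hTU)]) hA
  exact hp _ (Finset.filter_subset _ _) h' hh'

/-- A module of `g` cannot cross the branches of a prime node of `f`. -/
lemma subset_or_subset_of_module (N : Node K q e U) {l : ℕ} {f g h : BoolFun V} {A : Finset V}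
    (H : Compatible l f g) (h3 : 3 ≤ K.card) (hl : K.card ≤ l) (hp : Prim q K)
    (hF : Fac f (K.biUnion U) (comp q e)) (hsub : K.biUnion U ⊆ ess f) (hA : Fac g A h) :
    (∃ x ∈ K, A ∩ K.biUnion U ⊆ U x) ∨ K.biUnion U ⊆ A := by
  have hne : K.Nonempty := Finset.card_pos.1 (by omega)
  have key := fun τ hτ => N.card_filter_of_module H hne hl hp hF hsub hA (τ := τ) hτ
  have : ∀ x, ∃ i, x ∈ K → i ∈ U x ∧ ((A ∩ U x).Nonempty → i ∈ A) := fun x => by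
    by_cases hx : x ∈ K
    · by_cases hAx : (A ∩ U x).Nonempty
      · obtain ⟨i, hi⟩ := hAx
        rw [Finset.mem_inter] at hi
        exact ⟨i, fun _ => ⟨hi.2, fun _ => hi.1⟩⟩
      · exact ⟨(N.ne x hx).choose, fun _ => ⟨(N.ne x hx).choose_spec, fun h => absurd h hAx⟩⟩
    · exact ⟨x, fun h => absurd h hx⟩
  choose τ hτ using this
  by_cases hall : ∀ x ∈ K, τ x ∈ A
  · right
    intro b hb
    by_contra hbA
    obtain ⟨x, hx, hbx⟩ := Finset.mem_biUnion.1 hb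
    -- Exchanging one representative for `b ∉ A` leaves `K.card - 1 ≥ 2` of them in `A`: neither at
    -- most one nor all.
    have hfil : (K.filter fun y => Function.update τ x b y ∈ A) = K.erase x := by
      ext y
      by_cases hyx : y = x
      · subst hyx; simp [hbA]
      · simp only [Finset.mem_filter, Finset.mem_erase, Function.update_of_ne hyx]
        exact ⟨fun h => ⟨hyx, h.1⟩, fun h => ⟨h.2, hall y h.2⟩⟩
    have := key (Function.update τ x b) fun y hy => by
      by_cases hyx : y = x
      · subst hyx; simpa using hbx
      · rw [Function.update_of_ne hyx]; exact (hτ y hy).1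
    rw [hfil, Finset.card_erase_of_mem hx] at this
    rcases this with h1 | h1
    · omega
    · have := Finset.notMem_erase x K
      rw [h1] at this
      exact this hx
  · left
    rcases key τ fun x hx => (hτ x hx).1 with h1 | h1
    · obtain ⟨x, hx, hxf⟩ : ∃ x ∈ K, (K.filter fun x => τ x ∈ A) ⊆ {x} := by
        rcases Nat.le_one_iff_eq_zero_or_eq_one.1 h1 with h0 | h0
        · obtain ⟨x, hx⟩ := hne
          exact ⟨x, hx, by rw [Finset.card_eq_zero.1 h0]; simp⟩
        · obtain ⟨x, hx⟩ := Finset.card_eq_one.1 h0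
          have : x ∈ K.filter fun x => τ x ∈ A := by rw [hx]; simp
          exact ⟨x, (Finset.mem_filter.1 this).1, hx.le⟩
      refine ⟨x, hx, fun i hi => ?_⟩
      rw [Finset.mem_inter, Finset.mem_biUnion] at hi
      obtain ⟨hiA, y, hy, hiy⟩ := hi
      have := hxf (Finset.mem_filter.2 ⟨hy, (hτ y hy).2 ⟨i, Finset.mem_inter.2 ⟨hiA, hiy⟩⟩⟩)
      rw [Finset.mem_singleton] at this
      exact this ▸ hiy
    · exfalso
      apply hall
      intro x hx
      rw [← h1] at hx
      exact (Finset.mem_filter.1 hx).2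

lemma inter_subset_or_of_pair (_N : Node K q e U) (h2 : K.card = 2) (A : Finset V) :
    (∃ x ∈ K, A ∩ K.biUnion U ⊆ U x) ∨ ∀ x ∈ K, (A ∩ U x).Nonempty := by
  obtain ⟨x, y, hxy, hK⟩ := Finset.card_eq_two.1 h2
  by_cases hx : (A ∩ U x).Nonempty
  · by_cases hy : (A ∩ U y).Nonempty
    · right; simp [hK, hx, hy]
    · left
      refine ⟨x, by simp [hK], fun i hi => ?_⟩
      rw [Finset.mem_inter, Finset.mem_biUnion] at hi
      obtain ⟨hiA, z, hz, hiz⟩ := hi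
      simp only [hK, Finset.mem_insert, Finset.mem_singleton] at hz
      rcases hz with rfl | rfl
      · exact hiz
      · exact absurd ⟨i, Finset.mem_inter.2 ⟨hiA, hiz⟩⟩ hy
  · left
    refine ⟨y, by simp [hK], fun i hi => ?_⟩
    rw [Finset.mem_inter, Finset.mem_biUnion] at hi
    obtain ⟨hiA, z, hz, hiz⟩ := hi
    simp only [hK, Finset.mem_insert, Finset.mem_singleton] at hz
    rcases hz with rfl | rfl
    · exact absurd ⟨i, Finset.mem_inter.2 ⟨hiA, hiz⟩⟩ hx
    · exact hiz

lemma inter_eq_of_subset (N : Node K q e U) {A : Finset V} {x : V} (hx : x ∈ K)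
    (h : A ∩ K.biUnion U ⊆ U x) : A ∩ K.biUnion U = A ∩ U x :=
  Finset.Subset.antisymm (Finset.subset_inter Finset.inter_subset_left h)
    (Finset.inter_subset_inter (Finset.Subset.refl _) (N.subset hx))

end Node

/-- The part of a module of `g` inside a subfunction of `f` is robust. -/
lemma RO.robust_of_module {l : ℕ} {f g h e : BoolFun V} {U A : Finset V}
    (H : Compatible l f g) (hro : RO l e U) (hF : Fac f U e) (hU : U ⊆ ess f)
    (hA : Fac g A h) (hne : (A ∩ U).Nonempty) : Robust e (A ∩ U) := by
  induction hro with
  | leaf x s =>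
    obtain ⟨i, hi⟩ := hne
    rw [Finset.mem_inter, Finset.mem_singleton] at hi
    rw [Finset.inter_singleton_of_mem (hi.2 ▸ hi.1)]
    exact robust_singleton _ _
  | node K q e U N h2 hl hp he ih =>
    have ih' : ∀ x ∈ K, (A ∩ U x).Nonempty → Robust (e x) (A ∩ U x) := fun x hx =>
      ih x hx (hF.trans (N.fac hx) (N.subset hx)) ((N.subset hx).trans hU)
    have hone : ∀ x ∈ K, A ∩ K.biUnion U ⊆ U x → Robust (comp q e) (A ∩ K.biUnion U) := by
      intro x hx hAx
      have heq := N.inter_eq_of_subset hx hAx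
      rw [heq] at hne ⊢
      exact (N.fac hx).robust Finset.inter_subset_right hne (ih' x hx hne)
    have hall : (∀ x ∈ K, (A ∩ U x).Nonempty) → Robust (comp q e) (A ∩ K.biUnion U) := by
      intro hh
      refine N.robust Finset.inter_subset_right fun x hx => ?_
      rw [Finset.inter_assoc, Finset.inter_eq_right.2 (N.subset hx)]
      exact ⟨hh x hx, ih' x hx (hh x hx)⟩
    by_cases hK2 : K.card = 2
    · rcases N.inter_subset_or_of_pair hK2 A with ⟨x, hx, hAx⟩ | hh
      · exact hone x hx hAx
      · exact hall hh
    · rcases N.subset_or_subset_of_module H (by omega) hl (hp.resolve_left hK2) hF hU hA with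
        ⟨x, hx, hAx⟩ | hh
      · exact hone x hx hAx
      · refine hall fun x hx => ?_
        rw [Finset.inter_eq_right.2 ((N.subset hx).trans hh)]
        exact N.ne x hx

/-- The intersection of a module of `f` with a module of `g` is a module of `g`, when `f` and
`g` agree on the latter. -/
lemma Fac.inter_of_agreeOn {f g h e : BoolFun V} {A U : Finset V} (hg : Fac g A h)
    (hf : Fac f U e) (hne : A.Nonempty) (hA : AgreeOn f g A) : ∃ h', Fac g (A ∩ U) h' := by
  obtain ⟨p, hsep, hfg⟩ := hA
  obtain ⟨i, hi⟩ := hne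
  obtain ⟨α₀, hα₀, hs₀⟩ := hsep.congr hfg i hi
  -- On the agreement cube `g` is `h` up to negation and equals `f`, which sees `U` only through
  -- `e`. Equal values of this witness therefore give equal values of `h`.
  refine ⟨fun α => e (mix A α p), fun α β hαβ => hf.1 _ _ fun j hj => ?_, fun α β hαβ hh => ?_⟩
  · by_cases hjA : j ∈ A
    · rw [mix_mem hjA, mix_mem hjA, hαβ j (Finset.mem_inter.2 ⟨hjA, hj⟩)]
    · rw [mix_notMem hjA, mix_notMem hjA]
  · have h1 : f (mix A α p) = f (mix A β p) := hf.2 _ _ (fun j hj => by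
      by_cases hjA : j ∈ A
      · rw [mix_mem hjA, mix_mem hjA, hαβ j (by simp [hj])]
      · rw [mix_notMem hjA, mix_notMem hjA]) hh
    rw [hfg _ (eqOff_mix _ _ _), hfg _ (eqOff_mix _ _ _), hg.eq_iff hi hs₀
      ((eqOff_mix _ _ _).trans hα₀.symm) ((eqOff_mix _ _ _).trans hα₀.symm)] at h1
    have hm : ∀ γ, h (mix A γ p) = h γ := fun γ => hg.1 _ _ fun j hj => mix_mem hj _ _
    rw [hm, hm] at h1
    exact hg.2 _ _ (hαβ.mono Finset.inter_subset_left) h1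

/-- A minimal nontrivial module of `g` is a module of `f`. -/
theorem RO.exists_fac_of_module {l : ℕ} {f g h e : BoolFun V} {U A : Finset V}
    (H : Compatible l f g) (hro : RO l e U) (hF : Fac f U e) (hU : U ⊆ ess f)
    (hA : Fac g A h) (h2 : 2 ≤ A.card) (hAl : A.card ≤ l)
    (hmin : ∀ B ⊆ A, ∀ h', Fac g B h' → 2 ≤ B.card → A.card ≤ B.card) (hAU : A ⊆ U) :
    ∃ h', Fac f A h' := by
  have hne : A.Nonempty := Finset.card_pos.1 (by omega)
  induction hro with
  | leaf x s =>
    have := Finset.card_le_card hAU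
    rw [Finset.card_singleton] at this
    omega
  | node K q e U N hK2 hl hp he ih =>
    have ih' : ∀ x ∈ K, A ⊆ U x → ∃ h', Fac f A h' := fun x hx =>
      ih x hx (hF.trans (N.fac hx) (N.subset hx)) ((N.subset hx).trans hU)
    by_cases hK : K.card = 2
    · rcases N.inter_subset_or_of_pair hK A with ⟨x, hx, hAx⟩ | hh
      · rw [Finset.inter_eq_left.2 hAU] at hAx
        exact ih' x hx hAx
      · have hrob : Robust (comp q e) A := by
          have := (RO.node K q e U N hK2 hl hp he).robust_of_module H hF hU hA
            (by rwa [Finset.inter_eq_left.2 hAU])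
          rwa [Finset.inter_eq_left.2 hAU] at this
        have hag : AgreeOn f g A := H.robust A (hAU.trans hU) hAl (hF.robust hAU hne hrob)
        obtain ⟨x, y, hxy, hKxy⟩ := Finset.card_eq_two.1 hK
        have hx : x ∈ K := by simp [hKxy]
        have hy : y ∈ K := by simp [hKxy]
        -- The trace of `A` on a branch is again a module of `g`, smaller than `A` because `A` meets
        -- the other branch; by minimality it is a single variable.
        have hone : ∀ k ∈ K, ∀ k' ∈ K, k ≠ k' → ∃ i, A ∩ U k = {i} := by
          intro k hk k' hk' hkk
          rw [← Finset.card_eq_one]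
          have h1 := Finset.card_pos.2 (hh k hk)
          by_contra hne1
          obtain ⟨h', hh'⟩ := hA.inter_of_agreeOn (hF.trans (N.fac hk) (N.subset hk)) hne hag
          have h3 := hmin _ Finset.inter_subset_left h' hh' (by omega)
          obtain ⟨j, hj⟩ := hh k' hk'
          rw [Finset.mem_inter] at hj
          have hjk : j ∈ A ∩ U k := by
            rw [Finset.eq_of_subset_of_card_le Finset.inter_subset_left h3]; exact hj.1
          exact hkk (N.eq_of_mem hk hk' (Finset.mem_inter.1 hjk).2 hj.2)
        obtain ⟨a, ha⟩ := hone x hx y hy hxy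
        obtain ⟨b, hb⟩ := hone y hy x hx hxy.symm
        have haA : a ∈ A ∩ U x := by rw [ha]; simp
        have hbA : b ∈ A ∩ U y := by rw [hb]; simp
        have hAab : A = {a, b} := by
          rw [← Finset.inter_eq_left.2 hAU, hKxy, Finset.biUnion_insert,
            Finset.singleton_biUnion, Finset.inter_union_distrib_left, ha, hb]
          rfl
        rw [hAab] at hA hag ⊢
        exact N.pair_module H hKxy hxy (Finset.mem_inter.1 haA).2 (Finset.mem_inter.1 hbA).2
          hF hU he hA hag
    · rcases N.subset_or_subset_of_module H (by omega) hl (hp.resolve_left hK) hF hU hA with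
        ⟨x, hx, hAx⟩ | hh
      · rw [Finset.inter_eq_left.2 hAU] at hAx
        exact ih' x hx hAx
      · rw [Finset.Subset.antisymm hAU hh]
        exact ⟨_, hF⟩

/-- A lowest inner node has single variables as branches, hence at most `l` of them. -/
lemma RO.exists_module {l : ℕ} {e : BoolFun V} {U : Finset V} (hro : RO l e U)
    (h2 : 2 ≤ U.card) : ∃ A ⊆ U, 2 ≤ A.card ∧ A.card ≤ l ∧ ∃ h, Fac e A h := by
  induction hro with
  | leaf x s => simp at h2
  | node K q e U N hK2 hl hp he ih =>
    by_cases hx : ∃ x ∈ K, 2 ≤ (U x).card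
    · obtain ⟨x, hx, hx2⟩ := hx
      obtain ⟨A, hA, h2A, hAl, h, hh⟩ := ih x hx hx2
      exact ⟨A, hA.trans (N.subset hx), h2A, hAl, h, (N.fac hx).trans hh hA⟩
    · push Not at hx
      refine ⟨_, Finset.Subset.refl _, h2, ?_, comp q e, N.depOn, fun α β _ h => h⟩
      refine Finset.card_biUnion_le.trans ((Finset.sum_le_card_nsmul K _ 1 fun x hxK => ?_).trans
        (by simpa using hl))
      have := hx x hxK
      omega

end Transfer

end CheckingTest
namespace CheckingTest

/-! ### Contraction of a common module and the main induction. -/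

section Main

set_option linter.unusedSectionVars false

variable {V : Type*} [DecidableEq V] [Fintype V]

lemma sens_of_ne {f : BoolFun V} {β γ : V → Bool} {i : V} (h : EqOff {i} β γ)
    (hne : f β ≠ f γ) : Sens f γ i := by
  have : β = flipAt γ i := by
    funext j
    by_cases hj : j = i
    · subst hj
      rw [flipAt_self]
      by_contra hβ
      apply hne
      congr 1
      funext k
      by_cases hk : k = j
      · subst hk; revert hβ; cases β k <;> cases γ k <;> simp
      · exact h k (by simpa using hk)
    · rw [flipAt_of_ne _ hj]; exact h j (by simpa using hj)
  rw [this] at hne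
  exact hne

/-- On a cube containing all of `A` freely, `h` and `k` both equal `f = g` up to negation, so they
induce the same partition of the values of `A`. -/
lemma Fac.of_agreeOn {f g h k : BoolFun V} {A W : Finset V} (hf : Fac f A h) (hg : Fac g A k)
    (hne : A.Nonempty) (hAW : A ⊆ W) (hW : AgreeOn f g W) : Fac g A h := by
  obtain ⟨p, hsep, hfg⟩ := hW
  obtain ⟨i, hi⟩ := hne
  obtain ⟨α, hα, hs⟩ := hsep.congr hfg i (hAW hi)
  have hm : ∀ (e : BoolFun V), DepOn e A → ∀ β, e (mix A β α) = e β := fun e he β =>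
    he _ _ fun j hj => mix_mem hj _ _
  refine ⟨hf.1, fun β γ hβγ hh => hg.2 β γ hβγ ?_⟩
  have h1 : f (mix A β α) = f (mix A γ α) :=
    hf.2 _ _ ((eqOff_mix _ _ _).trans (eqOff_mix _ _ _).symm) (by rw [hm h hf.1, hm h hf.1, hh])
  rw [hfg _ (((eqOff_mix _ _ _).mono hAW).trans hα),
    hfg _ (((eqOff_mix _ _ _).mono hAW).trans hα),
    hg.eq_iff hi hs (eqOff_mix _ _ _) (eqOff_mix _ _ _), hm k hg.1, hm k hg.1] at h1
  exact h1

/-- Agreement of `f` and `g` passes to the functions obtained by contracting a common module to a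
single variable `a`. -/
lemma Fac.agreeOn_contract {f g h : BoolFun V} {A W : Finset V} {a : V} {α₀ : V → Bool}
    (hf : Fac f A h) (ha : a ∈ A)
    (hφ : ∀ α, f α = f (mix (A.erase a) α₀ (Function.update α a (h α))))
    (hψ : ∀ α, g α = g (mix (A.erase a) α₀ (Function.update α a (h α))))
    (hWA : ∀ i ∈ W, i ∈ A → i = a) (hW : AgreeOn f g W) :
    AgreeOn (fun α => f (mix (A.erase a) α₀ α)) (fun α => g (mix (A.erase a) α₀ α)) W := by
  obtain ⟨p, hsep, hfg⟩ := hW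
  have hoff : a ∉ W → ∀ α, EqOff W α p → h α = h p := fun haW α hα =>
    hf.1 _ _ fun j hj => hα j fun hjW => haW (hWA j hjW hj ▸ hjW)
  -- If `a` is not free, `h` is constant on the cube and `a` must carry that constant; if `a` is
  -- free, its value here is immaterial.
  refine ⟨Function.update p a (h p), fun i hi => ?_, fun α hα => ?_⟩
  · obtain ⟨α, hα, hs⟩ := hsep i hi
    refine ⟨Function.update α a (h α), fun j hj => ?_, ?_⟩
    · by_cases hja : j = a
      · subst hja; simpa using hoff hj α hα
      · rw [Function.update_of_ne hja, Function.update_of_ne hja]; exact hα j hj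
    · refine sens_of_ne (β := Function.update (flipAt α i) a (h (flipAt α i)))
        (fun j hj => ?_) ?_
      · have hji : j ≠ i := by simpa using hj
        by_cases hja : j = a
        · subst hja
          simp only [Function.update_self]
          exact hf.1 _ _ fun k hk => flipAt_of_ne _ fun hki => hji (hWA i hi (hki ▸ hk)).symm
        · rw [Function.update_of_ne hja, Function.update_of_ne hja, flipAt_of_ne _ hji]
      · rw [← hφ, ← hφ]
        exact hs
  -- Lift a point of the contracted cube to a point of the original cube at which `h` takes the
  -- value of `a`.
  · obtain ⟨α', hα', hA, hh⟩ : ∃ α', EqOff W α' p ∧ (∀ j, j ∉ A → α' j = α j) ∧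
        h α' = α a := by
      have hmW : EqOff W (mix W α p) p := eqOff_mix _ _ _
      have hmA : ∀ j, j ∉ A → mix W α p j = α j := fun j hj => by
        by_cases hjW : j ∈ W
        · exact mix_mem hjW _ _
        · rw [mix_notMem hjW, hα j hjW, Function.update_of_ne fun e : j = a => hj (e ▸ ha)]
      by_cases haW : a ∈ W
      · obtain ⟨α₁, hα₁, hs⟩ := hsep a haW
        have h1 : Sens h (mix W α p) a := by
          have h2 : Sens h (mix {a} (mix W α p) α₁) a :=
            (hf.sens_inner ha hs).of_eqOff_single (eqOff_mix _ _ _)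
          refine hf.1.sens h2 fun j hj => ?_
          by_cases hja : j = a
          · rw [mix_mem (U := {a}) (by simpa using hja)]
          · have hjW : j ∉ W := fun hjW => hja (hWA j hjW hj)
            rw [mix_notMem (U := {a}) (by simpa using hja), mix_notMem hjW, hα₁ j hjW]
        obtain ⟨α', h2, h3⟩ := h1.exists_value (α a)
        refine ⟨α', (h2.mono (by simpa using haW)).trans hmW, fun j hj => ?_, h3⟩
        rw [h2 j (by simp only [Finset.mem_singleton]; rintro rfl; exact hj ha), hmA j hj]
      · refine ⟨_, hmW, hmA, ?_⟩
        rw [hoff haW _ hmW, hα a haW, Function.update_self]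
    have hmix : mix (A.erase a) α₀ (Function.update α' a (h α')) = mix (A.erase a) α₀ α := by
      funext j
      by_cases hjB : j ∈ A.erase a
      · rw [mix_mem hjB, mix_mem hjB]
      · rw [mix_notMem hjB, mix_notMem hjB]
        by_cases hja : j = a
        · subst hja; simp [hh]
        · rw [Function.update_of_ne hja]
          exact hA j fun hj => hjB (Finset.mem_erase.2 ⟨hja, hj⟩)
    have := hfg α' hα'
    rwa [hφ, hψ, hmix] at this

/-- Two functions with a common module agree if they agree on a relevance hypercube containing
all variables outside the module and one variable of the module. -/
lemma Fac.eq_of_agreeOn {f g h : BoolFun V} {A W : Finset V} {a : V} (hf : Fac f A h)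
    (hg : Fac g A h) (ha : a ∈ A) (hgf : ess g ⊆ ess f) (hsub : insert a (ess f \ A) ⊆ W)
    (hW : AgreeOn f g W) : f = g := by
  obtain ⟨p, hsep, hfg⟩ := hW
  have haW : a ∈ W := hsub (by simp)
  obtain ⟨α₁, hα₁, hs⟩ := hsep a haW
  funext β
  have h1 : Sens h (mix (ess f \ A) β α₁) a :=
    hf.1.sens (hf.sens_inner ha hs) fun j hj => mix_notMem (by simp [hj]) _ _
  -- `α` copies the relevant part of `β` outside `A`, and `a` is adjusted so that `h` has the right
  -- value; `f` and `g` do not distinguish `α` from `β`.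
  obtain ⟨α, hα, hh⟩ := h1.exists_value (h β)
  have hαW : EqOff W α p := (hα.mono (by simpa using haW)).trans
    (((eqOff_mix _ _ _).mono ((Finset.subset_insert _ _).trans hsub)).trans hα₁)
  have key : ∀ e : BoolFun V, Fac e A h → ess e ⊆ ess f → e β = e α := fun e he hess => by
    rw [he.2 β (mix A α β) (eqOff_mix _ _ _).symm
      (by rw [← hh]; exact he.1 _ _ fun j hj => (mix_mem hj _ _).symm)]
    refine depOn_ess e _ _ fun j hj => ?_
    by_cases hjA : j ∈ A
    · rw [mix_mem hjA]
    · rw [mix_notMem hjA, hα j (by simp only [Finset.mem_singleton]; rintro rfl; exact hjA ha),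
        mix_mem (Finset.mem_sdiff.2 ⟨hess hj, hjA⟩)]
  rw [key f hf (Finset.Subset.refl _), key g hg hgf, hfg α hαW]

/-- The set of all relevant variables has a hypercube, so the robust `S` has one and extends to an
`l`-set. Robustness then finds a cube for `S` inside the agreement cube of that set. -/
lemma compatible_of_agreeOn {l : ℕ} (hl : 3 ≤ l) {f g : BoolFun V}
    (hg : IsReadOnce (basisB l) g) (hlf : l ≤ (ess f).card)
    (h : ∀ W, W.card = l → SepEx f W → AgreeOn f g W) : Compatible l f g := by
  refine ⟨hl, hg, h, fun S hS hSl hr => ?_⟩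
  obtain ⟨W, hSW, hWl, hWs⟩ := (hr _ (fun _ => false) hS (sep_ess f _)).sepEx.extend hSl hlf
  obtain ⟨p, hp, hfg⟩ := h W hWl hWs
  obtain ⟨p', hp', hs⟩ := hr W p hSW hp
  exact ⟨p', hs, fun α hα => hfg α ((hα.mono hSW).trans hp')⟩

/-- A nontrivial common module of `f` and `g`. -/
lemma Compatible.exists_common_module {l : ℕ} {f g : BoolFun V} (H : Compatible l f g)
    (hf : IsReadOnce (basisB l) f) (hlf : l ≤ (ess f).card) (hgf : ess g ⊆ ess f) :
    ∃ A ⊆ ess f, 2 ≤ A.card ∧ ∃ h, Fac f A h ∧ Fac g A h := by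
  have h3 := H.three_le
  have hfne : (ess f).Nonempty := Finset.card_pos.1 (by omega)
  have hg2 : 2 ≤ (ess g).card := by
    obtain ⟨W, -, hWl, hWs⟩ := SepEx.extend (f := f) (S := ∅) ⟨fun _ => false, by simp [Sep]⟩
      (m := l) (by simp) hlf
    obtain ⟨p, hp, hfg⟩ := H.sep W hWl hWs
    have := Finset.card_le_card (hp.congr hfg).subset_ess
    omega
  have hgro := H.readOnce.ro (Finset.card_pos.1 (show 0 < (ess g).card by omega))
  obtain ⟨A₀, hA₀, h2A₀, hA₀l, k₀, hk₀⟩ := hgro.exists_module hg2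
  classical
  obtain ⟨A, hA, hmin⟩ := Finset.exists_min_image
    ((ess g).powerset.filter fun A => 2 ≤ A.card ∧ ∃ h, Fac g A h) Finset.card
    ⟨A₀, Finset.mem_filter.2 ⟨Finset.mem_powerset.2 hA₀, h2A₀, k₀, hk₀⟩⟩
  obtain ⟨hAg, h2A, k, hk⟩ := by simpa only [Finset.mem_filter, Finset.mem_powerset] using hA
  have hAl : A.card ≤ l := (hmin A₀ (Finset.mem_filter.2
    ⟨Finset.mem_powerset.2 hA₀, h2A₀, k₀, hk₀⟩)).trans hA₀l
  have hAf := hAg.trans hgf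
  obtain ⟨h, hh⟩ := (hf.ro hfne).exists_fac_of_module H ⟨depOn_ess f, fun α β _ h => h⟩
    (Finset.Subset.refl _) hk h2A hAl (fun B hB h' hh' h2B => hmin B (Finset.mem_filter.2
      ⟨Finset.mem_powerset.2 (hB.trans hAg), h2B, h', hh'⟩)) hAf
  have hne : A.Nonempty := Finset.card_pos.1 (by omega)
  obtain ⟨i, hi⟩ := id hne
  -- It remains to make the inner functions equal: `A` has a hypercube, so it extends to an `l`-set
  -- on which `f` and `g` can be compared.
  obtain ⟨α, hα⟩ := mem_ess.1 (hAf hi)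
  have hAs : SepEx f A := by
    refine hh.sepEx (Finset.Subset.refl _) hi hα ⟨α, ?_⟩
    have := sep_ess h α
    rwa [hh.ess_eq hAf] at this
  obtain ⟨W, hAW, hWl, hWs⟩ := hAs.extend hAl hlf
  exact ⟨A, hAf, h2A, h, hh, hh.of_agreeOn hk hne hAW (H.sep W hWl hWs)⟩

theorem eq_of_agreeOn {l : ℕ} (hl : 3 ≤ l) {f g : BoolFun V} (hf : IsReadOnce (basisB l) f)
    (hg : IsReadOnce (basisB l) g) (hlf : l ≤ (ess f).card) (hgf : ess g ⊆ ess f)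
    (h : ∀ W, W.card = l → SepEx f W → AgreeOn f g W) : f = g := by
  obtain ⟨n, hn⟩ : ∃ n, (ess f).card = n := ⟨_, rfl⟩
  induction n using Nat.strong_induction_on generalizing f g with
  | _ n ih =>
    obtain ⟨A, hA, h2, k, hfk, hgk⟩ :=
      (compatible_of_agreeOn hl hg hlf h).exists_common_module hf hlf hgf
    obtain ⟨a, ha⟩ : A.Nonempty := Finset.card_pos.1 (by omega)
    obtain ⟨α₀, s, hval, hφ, hess⟩ := hfk.contract hA ha
    obtain ⟨k', hfk, hgk, hval, hφ⟩ : ∃ k', Fac f A k' ∧ Fac g A k' ∧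
        (∀ α, k' (mix (A.erase a) α₀ α) = α a) ∧
        ∀ α, f α = f (mix (A.erase a) α₀ (Function.update α a (k' α))) :=
      ⟨_, hfk.xor_right s, hgk.xor_right s, hval, hφ⟩
    have hψ : ∀ α, g α = g (mix (A.erase a) α₀ (Function.update α a (k' α))) := fun α => by
      refine hgk.2 _ _ (fun j hj => ?_) (by rw [hval, Function.update_self])
      rw [mix_notMem fun h => hj (Finset.mem_of_mem_erase h),
        Function.update_of_ne fun e : j = a => hj (e ▸ ha)]
    have hφsep : ∀ W, SepEx (fun α => f (mix (A.erase a) α₀ α)) W → SepEx f W := by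
      rintro W ⟨p, hp⟩
      refine ⟨mix (A.erase a) α₀ p, fun i hi => ?_⟩
      obtain ⟨α, hα, hs⟩ := hp i hi
      refine ⟨_, fun j hj => ?_, (sens_mix.1 hs).2⟩
      by_cases hjB : j ∈ A.erase a
      · rw [mix_mem hjB, mix_mem hjB]
      · rw [mix_notMem hjB, mix_notMem hjB, hα j hj]
    by_cases hcard : l ≤ (insert a (ess f \ A)).card
    · have hlt : (insert a (ess f \ A)).card < n := by
        rw [← hn, Finset.card_insert_of_notMem (by simp [ha]), Finset.card_sdiff_of_subset hA]
        have := Finset.card_le_card hA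
        omega
      have heq := ih _ hlt (hf.mix (A.erase a) α₀) (hg.mix (A.erase a) α₀) (by rwa [hess])
        (fun i hi => by
          obtain ⟨α, hα⟩ := mem_ess.1 hi
          obtain ⟨hiB, hs⟩ := sens_mix.1 hα
          have := hgf (mem_ess.2 ⟨_, hs⟩)
          rw [hess, Finset.mem_insert, Finset.mem_sdiff]
          by_cases hia : i = a
          · exact Or.inl hia
          · exact Or.inr ⟨this, fun hiA => hiB (Finset.mem_erase.2 ⟨hia, hiA⟩)⟩)
        (fun W hW hWs => hfk.agreeOn_contract ha hφ hψ (fun i hi hiA => by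
          have := hWs.choose_spec.subset_ess hi
          rw [hess, Finset.mem_insert, Finset.mem_sdiff] at this
          exact this.resolve_right fun h => h.2 hiA) (h W hW (hφsep W hWs))) (by rw [hess])
      funext α
      rw [hφ, hψ]
      exact congrFun heq _
    -- Too few variables remain for the induction hypothesis, but they fit into one `l`-set having a
    -- hypercube.
    · have hs : SepEx f (insert a (ess f \ A)) :=
        hφsep _ ⟨α₀, by have := sep_ess (fun α => f (mix (A.erase a) α₀ α)) α₀; rwa [hess] at this⟩
      obtain ⟨W, hsub, hWl, hWs⟩ := hs.extend (le_of_not_ge hcard) hlf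
      exact hfk.eq_of_agreeOn hgk ha hgf hsub (h W hWl hWs)

end Main

end CheckingTest

theorem mainTheorem1 (l n : ℕ) (hl : 3 ≤ l) (hln : l ≤ n)
    (f : CheckingTest.BoolFun (Fin n))
    (hf : CheckingTest.IsReadOnce (CheckingTest.basisB l) f)
    (hdep : ∀ i, CheckingTest.IsRelevant f i)
    (M : Set (Fin n → Bool))
    (hM : CheckingTest.IsRelevanceHypercubeSet l f M) :
    CheckingTest.IsCheckingTest (CheckingTest.basisB l) f M := by
  intro g hg hne
  by_contra! hM'
  have hess : CheckingTest.ess f = Finset.univ := Finset.eq_univ_of_forall fun i =>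
    CheckingTest.mem_ess.2 (CheckingTest.isRelevant_iff.1 (hdep i))
  refine hne (CheckingTest.eq_of_agreeOn hl hf hg (by simpa [hess]) (by simp [hess]) ?_).symm
  rintro W hW ⟨p₀, hp₀⟩
  obtain ⟨H, hH, hHM⟩ := hM W hW (fun i _ => hdep i)
    ⟨_, CheckingTest.isRelevanceHypercube_subcube.2 hp₀⟩
  obtain ⟨p, rfl⟩ := hH.1
  exact ⟨p, CheckingTest.isRelevanceHypercube_subcube.1 hH, fun α hα => hM' α (hHM hα)⟩
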